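/- All graphs are finite and simple. A dissociation set of a graph $G$ is a set of vertices inducing a subgraph of maximum degree at most $1$; $m(G)$ denotes the number of dissociation sets of $G$ of maximum cardinality. A potted graph is a connected graph containing exactly one cycle such that exactly one vertex of this cycle has degree larger than $2$ in $G$. Let $\mathcal P(n,k)$ be the set of potted graphs of order $n$ whose cycle has order $k$. $P_n$ and $C_n$ are the path and the cycle of order $n$. For vertex-disjoint trees $T_1,\dots,T_r$, let $G_w(T_1,\dots,T_r)$ be a tree obtained from $T_1\cup\dots\cup T_r$ by choosing a leaf in each $T_i$ and identifying these $r$ leaves to a single vertex $w$. Let $C_k+_e G_w(T_1,\dots,T_r)$ be the graph obtained from the disjoint union of $C_k$ and $G_w(T_1,\dots,T_r)$ by adding an edge between $w$ and a vertex of $C_k$, and let $C_k\odot G_w(T_1,\dots,T_r)$ be the graph obtained from the same union by identifying $w$ with a vertex of $C_k$. Up to isomorphism, and with $l\ge 0$ and each $T_i\in\{P_4,K_{1,3}\}$ arbitrary, put - $\mathcal T_1=\{G_w(P_3,P_4,\dots,P_4)\}$ with any number ($\ge 0$) of copies of $P_4$ (with no copy this is $P_3$ with $w$ an end vertex); - $\mathcal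 T_2=\{G_w(P_2,P_3,T_1,\dots,T_l)\}$; - $\mathcal T_3=\{G_w(P_3,P_3,T_1,\dots,T_l)\}$; - $\mathcal T_4=\{G_w(P_2,P_2,P_3,T_1,\dots,T_l)\}$; - $\mathcal T_5=\{G_w(P_2,P_2,P_2,P_2,T_1,\dots,T_l)\}$; - $\mathcal G_j=\{C_k+_e T: T\in\mathcal T_j\}$ for $1\le j\le 5$; - $\mathcal G_6=\{C_k\odot G_w(P_3,T_1,\dots,T_l)\}$; - $\mathcal G_7=\{C_k\odot G_w(P_2,P_2,T_1,\dots,T_l)\}$. Theorem. Let $n,k$ be positive integers with $n\ge k+4$ and $k\equiv 0\pmod 3$, and let $G\in\mathcal P(n,k)$. Then $$m(G)\le\begin{cases}3^{(n-k)/3}+\frac13(n-k)+1,& n\equiv 0\pmod 3,\\ 3^{(n-k-1)/3}+1,& n\equiv 1\pmod 3,\\ 3^{(n-k-2)/3},& n\equiv 2\pmod 3,\end{cases}$$ with equality if and only if $G\in\mathcal G_1$, $G\in\mathcal G_2$, or $G\in\bigcup_{i=3}^{7}\mathcal G_i$, in the three cases respectively. -/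

import Mathlib

noncomputable section

open SimpleGraph

universe u

/-! ### Dissociation sets -/

section Dissociation

variable {V : Type u}

/-- A set of vertices is a dissociation set if it induces a subgraph in which every vertex has
degree at most one. -/
def IsDissociationSet (G : SimpleGraph V) (S : Finset V) : Prop :=
  ∀ v : (S : Set V), ((G.induce (S : Set V)).neighborSet v).ncard ≤ 1

/-- A maximum dissociation set is a dissociation set of the largest cardinality. -/
def IsMaxDissociationSet (G : SimpleGraph V) (S : Finset V) : Prop :=
  IsDissociationSet G S ∧ ∀ T : Finset V, IsDissociationSet G T → T.card ≤ S.card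

/-- `m(G)`, the number of maximum dissociation sets of a finite graph. -/
def numMaxDissociationSets (G : SimpleGraph V) : ℕ :=
  {S : Finset V | IsMaxDissociationSet G S}.ncard

end Dissociation

/-! ### Potted graphs -/

section Potted

variable {V : Type u}

/-- A subgraph is a cycle of `G` if it is traced out by a closed walk that is a cycle. -/
def IsCycleSubgraph (G : SimpleGraph V) (C : G.Subgraph) : Prop :=
  ∃ (v : V) (c : G.Walk v v), c.IsCycle ∧ c.toSubgraph = C

/-- `G ∈ 𝒫(n, k)`: `G` has order `n`, it is connected and contains exactly one cycle `C`
(so it is unicyclic), `C` has order `k`, and exactly one vertex of `C` has degree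
larger than `2` in `G`. -/
def IsPotted [Fintype V] (G : SimpleGraph V) (n k : ℕ) : Prop :=
  Fintype.card V = n ∧ G.Connected ∧
    ∃ C : G.Subgraph, IsCycleSubgraph G C ∧ (∀ C' : G.Subgraph, IsCycleSubgraph G C' → C' = C) ∧
      C.verts.ncard = k ∧ ∃! w : V, w ∈ C.verts ∧ 2 < (G.neighborSet w).ncard

end Potted

/-! ### Graphs with a distinguished vertex, and gluing them together -/

/-- A graph with a distinguished vertex. -/
structure PointedGraph where
  /-- the vertices -/
  Vert : Type
  /-- the graph -/
  graph : SimpleGraph Vert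
  /-- the distinguished vertex -/
  root : Vert

/-- The vertices of the disjoint union of the graphs in `L` after all distinguished vertices
have been identified: `none` is the identified vertex, and the other vertices are
the non-distinguished vertices of the graphs in `L`. -/
abbrev GlueVert (L : List PointedGraph) : Type :=
  Option (Σ i : Fin L.length, {x : (L.get i).Vert // x ≠ (L.get i).root})

open Classical in
/-- The map from the `i`-th graph of `L` to the glued graph. -/
def glueIncl (L : List PointedGraph) (i : Fin L.length) (x : (L.get i).Vert) : GlueVert L :=
  if h : x = (L.get i).root then none else some ⟨i, x, h⟩

/-- The graph obtained from the disjoint union of the graphs in `L` by identifying all their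
distinguished vertices; the identified vertex is the distinguished vertex of the result.
If the distinguished vertices are leaves `vᵢ` of trees `Tᵢ`, this is `G_w(T₁, …, T_r)`
with `w` the distinguished vertex. -/
def glue (L : List PointedGraph) : PointedGraph where
  Vert := GlueVert L
  graph := ⨆ i : Fin L.length, (L.get i).graph.map (glueIncl L i)
  root := none

/-- The path `P_n` of order `n`, the distinguished vertex being an end vertex. -/
def leafPath (n : ℕ) [NeZero n] : PointedGraph := ⟨Fin n, pathGraph n, 0⟩

/-- The star `K_{1,3}`, the distinguished vertex being a leaf. -/
def leafClaw : PointedGraph :=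
  ⟨Fin 1 ⊕ Fin 3, completeBipartiteGraph (Fin 1) (Fin 3), Sum.inr 0⟩

/-- Every graph in the list is `P_4` or `K_{1,3}` (with a leaf as its distinguished vertex). -/
def AllP4OrClaw (L : List PointedGraph) : Prop :=
  ∀ T ∈ L, T = leafPath 4 ∨ T = leafClaw

/-! ### The families `𝒯_1, …, 𝒯_5` of trees with branch vertex `w` -/

/-- `P_3` (with `w` an end vertex, the case `l = 0`) and `G_w(P_3, P_4, …, P_4)`. -/
def treeFamily1 : Set PointedGraph :=
  {T | ∃ l : ℕ, T = glue (leafPath 3 :: List.replicate l (leafPath 4))}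

/-- `G_w(P_2, P_3, T_1, …, T_l)` with `l ≥ 0` and each `T_i` equal to `P_4` or `K_{1,3}`. -/
def treeFamily2 : Set PointedGraph :=
  {T | ∃ L : List PointedGraph, AllP4OrClaw L ∧ T = glue (leafPath 2 :: leafPath 3 :: L)}

/-- `G_w(P_3, P_3, T_1, …, T_l)` with `l ≥ 0` and each `T_i` equal to `P_4` or `K_{1,3}`. -/
def treeFamily3 : Set PointedGraph :=
  {T | ∃ L : List PointedGraph, AllP4OrClaw L ∧ T = glue (leafPath 3 :: leafPath 3 :: L)}

/-- `G_w(P_2, P_2, P_3, T_1, …, T_l)` with `l ≥ 0` and each `T_i` equal to `P_4` or `K_{1,3}`. -/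
def treeFamily4 : Set PointedGraph :=
  {T | ∃ L : List PointedGraph, AllP4OrClaw L ∧
    T = glue (leafPath 2 :: leafPath 2 :: leafPath 3 :: L)}

/-- `G_w(P_2, P_2, P_2, P_2, T_1, …, T_l)` with `l ≥ 0` and each `T_i` equal to `P_4` or
`K_{1,3}`. -/
def treeFamily5 : Set PointedGraph :=
  {T | ∃ L : List PointedGraph, AllP4OrClaw L ∧
    T = glue (leafPath 2 :: leafPath 2 :: leafPath 2 :: leafPath 2 :: L)}

/-! ### The families `𝒢_1, …, 𝒢_7` of potted graphs -/

/-- `C_k +_e T`: the disjoint union of `C_k` and `T` with an edge added between the vertex `c` of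
`C_k` and the distinguished vertex of `T`. -/
def cycleAddEdge (k : ℕ) (c : Fin k) (T : PointedGraph) : SimpleGraph (Fin k ⊕ T.Vert) :=
  (cycleGraph k ⊕g T.graph) ⊔ edge (Sum.inl c) (Sum.inr T.root)

/-- `C_k ⊙ T`: the disjoint union of `C_k` and `T` with the vertex `c` of `C_k` identified with
the distinguished vertex of `T`. -/
def cycleIdentify (k : ℕ) (c : Fin k) (T : PointedGraph) : PointedGraph :=
  glue [⟨Fin k, cycleGraph k, c⟩, T]

/-- The graphs isomorphic to `C_k +_e T` for some `T` in the family `𝒯`. -/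
def edgeFamily (V : Type u) (k : ℕ) (𝒯 : Set PointedGraph) : Set (SimpleGraph V) :=
  {G | ∃ T ∈ 𝒯, ∃ c : Fin k, Nonempty (G ≃g cycleAddEdge k c T)}

/-- `𝒢_1 = {C_k +_e T : T ∈ 𝒯_1}`, up to isomorphism. -/
def potFamily1 (V : Type u) (k : ℕ) : Set (SimpleGraph V) := edgeFamily V k treeFamily1

/-- `𝒢_2 = {C_k +_e T : T ∈ 𝒯_2}`, up to isomorphism. -/
def potFamily2 (V : Type u) (k : ℕ) : Set (SimpleGraph V) := edgeFamily V k treeFamily2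

/-- `𝒢_3 = {C_k +_e T : T ∈ 𝒯_3}`, up to isomorphism. -/
def potFamily3 (V : Type u) (k : ℕ) : Set (SimpleGraph V) := edgeFamily V k treeFamily3

/-- `𝒢_4 = {C_k +_e T : T ∈ 𝒯_4}`, up to isomorphism. -/
def potFamily4 (V : Type u) (k : ℕ) : Set (SimpleGraph V) := edgeFamily V k treeFamily4

/-- `𝒢_5 = {C_k +_e T : T ∈ 𝒯_5}`, up to isomorphism. -/
def potFamily5 (V : Type u) (k : ℕ) : Set (SimpleGraph V) := edgeFamily V k treeFamily5

/-- `𝒢_6 = {C_k ⊙ G_w(P_3, T_1, …, T_l) : T_i = P_4 or K_{1,3}}`, up to isomorphism. -/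
def potFamily6 (V : Type u) (k : ℕ) : Set (SimpleGraph V) :=
  {G | ∃ L : List PointedGraph, AllP4OrClaw L ∧ ∃ c : Fin k,
    Nonempty (G ≃g (cycleIdentify k c (glue (leafPath 3 :: L))).graph)}

/-- `𝒢_7 = {C_k ⊙ G_w(P_2, P_2, T_1, …, T_l) : T_i = P_4 or K_{1,3}}`, up to isomorphism. -/
def potFamily7 (V : Type u) (k : ℕ) : Set (SimpleGraph V) :=
  {G | ∃ L : List PointedGraph, AllP4OrClaw L ∧ ∃ c : Fin k,
    Nonempty (G ≃g (cycleIdentify k c (glue (leafPath 2 :: leafPath 2 :: L))).graph)}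

end

/-! Because the cycle is unique and only one of its vertices, w, has degree above 2, the graph is
C_k with rooted trees (branches) joined by edges to w (`IsPotted.exists_pointedIso`). Let N = n - k
be their total order.

Dissociation sets of a rooted graph are sorted by whether the root is outside, isolated or matched.
Joining two roots by an edge combines the three generating polynomials through products. Only three
patterns of relative top degrees occur (`RootKind`), so the leading coefficients obey the explicit
recursion `RootCount.join`.

C_{3m} has exactly three maximum dissociation sets, the complements of the residue classes mod 3.
One avoids w and the other two match it, which gives the counts (1, 0, 2). For a branch let `total`
be its number of maximum sets and `out` the number of largest sets avoiding its root. If the root of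
every branch is free, then m(G) = ∏ total + 2 ∏ out. If some branch root lies in all maximum sets of
its branch, using w costs a vertex and only ∏ total remains.

A tree of order three has total 3, while a tree of larger order s has total at most (2/3)·3^⌊s/3⌋
(`Bounded.exists_total_le`). So branches of order above three are wasteful unless the term 2 ∏ out
compensates, which requires a single free branch T, worth 3·out + isol + pair. As `out` is the
product of the totals of the subtrees at the root of T, the same principle applies one level down:
those subtrees have order at most three. They are i single vertices, j edges and some trees of order
three, and a case analysis on (i, j) gives bounds and equality cases (`potBound`). The linear term
in the first bound arises for (i, j) = (0, 1): the root of T can be isolated, or matched to the root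
of the edge or of any P_3 rooted at an end. A P_3 rooted at its centre offers no such match, so the
claw is absent from the first family.

Gluing at w is identified with attaching branches because a one-point union is unique up to
isomorphism (`IsWedge.unique`). -/

noncomputable section

open SimpleGraph

universe u

/-! ### Generating polynomials of dissociation sets -/

section Polynomials

open Polynomial
open scoped Classical

variable {V W : Type*}

/-- No vertex of `S` has two neighbours in `S`. -/
def Dissociated (G : SimpleGraph V) (S : Finset V) : Prop :=
  ∀ v ∈ S, ∀ a ∈ S, ∀ b ∈ S, G.Adj v a → G.Adj v b → a = b

/-- The vertex `r` has no neighbour in `S`. -/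
def IsolatedFrom (G : SimpleGraph V) (r : V) (S : Finset V) : Prop :=
  ∀ a ∈ S, ¬ G.Adj r a

theorem isDissociationSet_iff (G : SimpleGraph V) (S : Finset V) :
    IsDissociationSet G S ↔ Dissociated G S := by
  have key : ∀ v : (S : Set V), ((G.induce (S : Set V)).neighborSet v).ncard ≤ 1 ↔
      ∀ a ∈ S, ∀ b ∈ S, G.Adj v a → G.Adj v b → a = b := by
    intro v
    rw [Set.ncard_le_one (Set.toFinite _)]
    constructor
    · intro h a ha b hb hva hvb
      exact congrArg Subtype.val (h ⟨a, ha⟩ hva ⟨b, hb⟩ hvb)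
    · intro h a ha b hb
      exact Subtype.ext (h a a.2 b b.2 ha hb)
  constructor
  · intro h v hv
    exact (key ⟨v, hv⟩).1 (h ⟨v, hv⟩)
  · intro h v
    exact (key v).2 (h v v.2)

/-- The disjoint union of two graphs, with an edge joining the vertices `r` and `s`. -/
def joinByEdge (G : SimpleGraph V) (H : SimpleGraph W) (r : V) (s : W) : SimpleGraph (V ⊕ W) :=
  (G ⊕g H) ⊔ edge (Sum.inl r) (Sum.inr s)

@[simp] theorem joinByEdge_inl_inl {G : SimpleGraph V} {H : SimpleGraph W} {r : V} {s : W}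
    {a b : V} : (joinByEdge G H r s).Adj (Sum.inl a) (Sum.inl b) ↔ G.Adj a b := by
  simp [joinByEdge, edge_adj]

@[simp] theorem joinByEdge_inr_inr {G : SimpleGraph V} {H : SimpleGraph W} {r : V} {s : W}
    {a b : W} : (joinByEdge G H r s).Adj (Sum.inr a) (Sum.inr b) ↔ H.Adj a b := by
  simp [joinByEdge, edge_adj]

@[simp] theorem joinByEdge_inl_inr {G : SimpleGraph V} {H : SimpleGraph W} {r : V} {s : W}
    {a : V} {b : W} : (joinByEdge G H r s).Adj (Sum.inl a) (Sum.inr b) ↔ a = r ∧ b = s := by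
  simp [joinByEdge, edge_adj]

@[simp] theorem joinByEdge_inr_inl {G : SimpleGraph V} {H : SimpleGraph W} {r : V} {s : W}
    {a : V} {b : W} : (joinByEdge G H r s).Adj (Sum.inr b) (Sum.inl a) ↔ a = r ∧ b = s := by
  rw [adj_comm, joinByEdge_inl_inr]

/-- The new edge matters only when both its ends are chosen. They are then matched to each other, so
neither may have a further neighbour. -/
theorem dissociated_joinByEdge {G : SimpleGraph V} {H : SimpleGraph W} {r : V} {s : W}
    (A : Finset V) (B : Finset W) :
    Dissociated (joinByEdge G H r s) (A.disjSum B) ↔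
      Dissociated G A ∧ Dissociated H B ∧
        (r ∈ A → s ∈ B → IsolatedFrom G r A ∧ IsolatedFrom H s B) := by
  constructor
  · intro h
    refine ⟨?_, ?_, ?_⟩
    · intro v hv a ha b hb hva hvb
      simpa using h (Sum.inl v) (by simpa) (Sum.inl a) (by simpa) (Sum.inl b) (by simpa)
        (by simpa) (by simpa)
    · intro v hv a ha b hb hva hvb
      simpa using h (Sum.inr v) (by simpa) (Sum.inr a) (by simpa) (Sum.inr b) (by simpa)
        (by simpa) (by simpa)
    · intro hr hs
      refine ⟨fun a ha hra => ?_, fun a ha hsa => ?_⟩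
      · simpa using h (Sum.inl r) (by simpa) (Sum.inl a) (by simpa) (Sum.inr s) (by simpa)
          (by simpa) (by simp)
      · simpa using h (Sum.inr s) (by simpa) (Sum.inr a) (by simpa) (Sum.inl r) (by simpa)
          (by simpa) (by simp)
  · rintro ⟨hA, hB, hrs⟩ v hv a ha b hb hva hvb
    have hA' := fun v hv a ha b hb => hA v hv a ha b hb
    rcases v with v | v <;> rcases a with a | a <;> rcases b with b | b <;>
      simp only [Finset.inl_mem_disjSum, Finset.inr_mem_disjSum, joinByEdge_inl_inl,
        joinByEdge_inr_inr, joinByEdge_inl_inr, joinByEdge_inr_inl] at hv ha hb hva hvb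
    · rw [hA v hv a ha b hb hva hvb]
    · obtain ⟨rfl, rfl⟩ := hvb
      exact absurd hva ((hrs hv hb).1 a ha)
    · obtain ⟨rfl, rfl⟩ := hva
      exact absurd hvb ((hrs hv ha).1 b hb)
    · rw [hva.2, hvb.2]
    · rw [hva.1, hvb.1]
    · obtain ⟨rfl, rfl⟩ := hva
      exact absurd hvb ((hrs ha hv).2 b hb)
    · obtain ⟨rfl, rfl⟩ := hvb
      exact absurd hva ((hrs hb hv).2 a ha)
    · rw [hB v hv a ha b hb hva hvb]

theorem isolatedFrom_joinByEdge {G : SimpleGraph V} {H : SimpleGraph W} {r : V} {s : W}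
    (A : Finset V) (B : Finset W) :
    IsolatedFrom (joinByEdge G H r s) (Sum.inl r) (A.disjSum B) ↔
      IsolatedFrom G r A ∧ s ∉ B := by
  constructor
  · intro h
    refine ⟨fun a ha hra => h (Sum.inl a) (by simpa) (by simpa), fun hs => ?_⟩
    exact h (Sum.inr s) (by simpa) (by simp)
  · rintro ⟨h1, h2⟩ (a | a) ha hra
    · exact h1 a (by simpa using ha) (by simpa using hra)
    · simp only [joinByEdge_inl_inr, true_and] at hra
      subst hra
      exact h2 (by simpa using ha)

variable [Fintype V] [Fintype W]

/-- The generating polynomial, by cardinality, of the sets of vertices with property `p`. -/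
def setPoly (p : Finset V → Prop) : ℕ[X] := ∑ S : Finset V, if p S then X ^ S.card else 0

/-- The generating polynomial of the dissociation sets avoiding `r`. -/
def outPoly (G : SimpleGraph V) (r : V) : ℕ[X] := setPoly fun S => Dissociated G S ∧ r ∉ S

/-- The generating polynomial of the dissociation sets in which `r` is an isolated vertex. -/
def isolPoly (G : SimpleGraph V) (r : V) : ℕ[X] :=
  setPoly fun S => Dissociated G S ∧ r ∈ S ∧ IsolatedFrom G r S

/-- The generating polynomial of the dissociation sets in which `r` has a neighbour. -/
def pairPoly (G : SimpleGraph V) (r : V) : ℕ[X] :=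
  setPoly fun S => Dissociated G S ∧ r ∈ S ∧ ¬ IsolatedFrom G r S

theorem setPoly_dissociated (G : SimpleGraph V) (r : V) :
    setPoly (Dissociated G) = outPoly G r + isolPoly G r + pairPoly G r := by
  simp only [setPoly, outPoly, isolPoly, pairPoly, ← Finset.sum_add_distrib]
  refine Finset.sum_congr rfl fun S _ => ?_
  by_cases h1 : Dissociated G S <;> by_cases h2 : r ∈ S <;> by_cases h3 : IsolatedFrom G r S <;>
    simp [h1, h2, h3]

theorem setPoly_sum (p : Finset (V ⊕ W) → Prop) :
    setPoly p = ∑ A : Finset V, ∑ B : Finset W,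
      if p (A.disjSum B) then X ^ (A.card + B.card) else 0 := by
  rw [setPoly, ← Fintype.sum_prod_type']
  refine Fintype.sum_equiv Finset.sumEquiv.toEquiv _ _ fun S => ?_
  have : S.toLeft.disjSum S.toRight = S := Finset.toLeft_disjSum_toRight
  simp [Finset.sumEquiv, this, Finset.card_toLeft_add_card_toRight]

theorem setPoly_mul (p : Finset V → Prop) (q : Finset W → Prop) :
    setPoly p * setPoly q = ∑ A : Finset V, ∑ B : Finset W,
      if p A ∧ q B then X ^ (A.card + B.card) else 0 := by
  rw [setPoly, setPoly, Finset.sum_mul_sum]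
  refine Finset.sum_congr rfl fun A _ => Finset.sum_congr rfl fun B _ => ?_
  by_cases h1 : p A <;> by_cases h2 : q B <;> simp [h1, h2, pow_add]

variable (G : SimpleGraph V) (H : SimpleGraph W) (r : V) (s : W)

theorem outPoly_joinByEdge : outPoly (joinByEdge G H r s) (Sum.inl r) =
    outPoly G r * (outPoly H s + isolPoly H s + pairPoly H s) := by
  rw [← setPoly_dissociated, outPoly, outPoly, setPoly_sum, setPoly_mul]
  refine Finset.sum_congr rfl fun A _ => Finset.sum_congr rfl fun B _ => ?_
  congr 1
  rw [dissociated_joinByEdge, Finset.inl_mem_disjSum]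
  apply propext
  tauto

theorem isolPoly_joinByEdge : isolPoly (joinByEdge G H r s) (Sum.inl r) =
    isolPoly G r * outPoly H s := by
  rw [isolPoly, isolPoly, outPoly, setPoly_sum, setPoly_mul]
  refine Finset.sum_congr rfl fun A _ => Finset.sum_congr rfl fun B _ => ?_
  congr 1
  rw [dissociated_joinByEdge, isolatedFrom_joinByEdge, Finset.inl_mem_disjSum]
  apply propext
  tauto

/-- A matched root either keeps its old partner, which forces `s` out, or is newly matched to `s`,
both roots having been isolated on their own sides. -/
theorem pairPoly_joinByEdge : pairPoly (joinByEdge G H r s) (Sum.inl r) =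
    pairPoly G r * outPoly H s + isolPoly G r * isolPoly H s := by
  rw [pairPoly, pairPoly, isolPoly, outPoly, isolPoly, setPoly_sum, setPoly_mul, setPoly_mul,
    ← Finset.sum_add_distrib]
  refine Finset.sum_congr rfl fun A _ => ?_
  rw [← Finset.sum_add_distrib]
  refine Finset.sum_congr rfl fun B _ => ?_
  rw [dissociated_joinByEdge, isolatedFrom_joinByEdge, Finset.inl_mem_disjSum]
  by_cases h1 : Dissociated G A <;> by_cases h2 : Dissociated H B <;> by_cases h3 : r ∈ A <;>
    by_cases h4 : s ∈ B <;> by_cases h5 : IsolatedFrom G r A <;>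
    by_cases h6 : IsolatedFrom H s B <;> simp [h1, h2, h3, h4, h5, h6]

end Polynomials

/-! ### Leading coefficients -/

section LeadingCoefficients

open Polynomial

/-- The degree of `p` is at most `d`, and the coefficient of `X ^ d` is `k`. -/
def TopCoeff (p : ℕ[X]) (d k : ℕ) : Prop := p.natDegree ≤ d ∧ p.coeff d = k

theorem TopCoeff.mul {p q : ℕ[X]} {m n a b : ℕ} (hp : TopCoeff p m a) (hq : TopCoeff q n b) :
    TopCoeff (p * q) (m + n) (a * b) :=
  ⟨natDegree_mul_le_of_le hp.1 hq.1, by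
    rw [coeff_mul_add_eq_of_natDegree_le hp.1 hq.1, hp.2, hq.2]⟩

theorem TopCoeff.add {p q : ℕ[X]} {m a b : ℕ} (hp : TopCoeff p m a) (hq : TopCoeff q m b) :
    TopCoeff (p + q) m (a + b) :=
  ⟨natDegree_add_le_of_degree_le hp.1 hq.1, by rw [coeff_add, hp.2, hq.2]⟩

/-- Raising the degree bound turns the coefficient into zero. Classes of sets that have become too
small to compete are thus recorded with count 0. -/
theorem TopCoeff.of_le {p : ℕ[X]} {m n a : ℕ} (hp : TopCoeff p m a) (h : m ≤ n) :
    TopCoeff p n (if m = n then a else 0) := by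
  split_ifs with hmn
  · exact hmn ▸ hp
  · exact ⟨hp.1.trans h, coeff_eq_zero_of_natDegree_lt (hp.1.trans_lt (lt_of_le_of_ne h hmn))⟩

end LeadingCoefficients

/-! ### Root counts and their recursion -/

/-- The status of the root in the maximum dissociation sets of a pointed graph: `isolated` if it
always belongs to them and is isolated in some of them, `matched` if it always belongs to them and
always has a neighbour in them, and `free` if it is avoided by some of them. -/
inductive RootKind
  | isolated | matched | free

/-- The excess, over the sets avoiding the root, of the sets in which the root is isolated. -/
def RootKind.isolExcess : RootKind → ℕ
  | isolated => 1 | matched => 0 | free => 0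

/-- The excess, over the sets avoiding the root, of the sets in which the root has a neighbour. -/
def RootKind.pairExcess : RootKind → ℕ
  | isolated => 1 | matched => 1 | free => 0

/-- The kind of the root, and the numbers of the largest dissociation sets for which the root is
respectively outside, isolated, and matched. -/
structure RootCount where
  /-- the status of the root -/
  kind : RootKind
  /-- the number of largest sets avoiding the root -/
  out : ℕ
  /-- the number of largest sets in which the root is isolated -/
  isol : ℕ
  /-- the number of largest sets in which the root is matched -/
  pair : ℕ

namespace RootCount

/-- The number of maximum dissociation sets. -/
def total (D : RootCount) : ℕ :=
  match D.kind with
  | .isolated => D.isol + D.pair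
  | .matched => D.pair
  | .free => D.out + D.isol + D.pair

/-- The effect on the counts of attaching a branch to the root. -/
def join (D E : RootCount) : RootCount :=
  match D.kind, E.kind with
  | .isolated, .free =>
    ⟨.isolated, D.out * E.total, D.isol * E.out, D.pair * E.out + D.isol * E.isol⟩
  | .isolated, .isolated => ⟨.matched, D.out * E.total, D.isol * E.out, D.isol * E.isol⟩
  | .isolated, .matched =>
    ⟨.free, D.out * E.total, D.isol * E.out, D.pair * E.out + D.isol * E.isol⟩
  | .matched, .free => ⟨.matched, D.out * E.total, D.isol * E.out, D.pair * E.out⟩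
  | .matched, .isolated => ⟨.free, D.out * E.total, 0, D.pair * E.out + D.isol * E.isol⟩
  | .matched, .matched => ⟨.free, D.out * E.total, 0, D.pair * E.out⟩
  | .free, .free => ⟨.free, D.out * E.total, D.isol * E.out, D.pair * E.out + D.isol * E.isol⟩
  | .free, .isolated => ⟨.free, D.out * E.total, 0, D.isol * E.isol⟩
  | .free, .matched => ⟨.free, D.out * E.total, 0, 0⟩

end RootCount

/-- `D` records the largest dissociation sets of the pointed graph `(G, r)`. -/
def HasRootCount {V : Type*} [Fintype V] (G : SimpleGraph V) (r : V) (D : RootCount) : Prop :=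
  ∃ e : ℕ, TopCoeff (outPoly G r) e D.out ∧
    TopCoeff (isolPoly G r) (e + D.kind.isolExcess) D.isol ∧
    TopCoeff (pairPoly G r) (e + D.kind.pairExcess) D.pair

-- The new reference degree is that of the sets avoiding `r`: `m` plus the largest degree on the
-- side of `H`. A product missing from `RootCount.join` is one whose degree falls below the degree
-- recorded for its class.
open RootKind in
theorem HasRootCount.joinByEdge {V W : Type*} [Fintype V] [Fintype W] {G : SimpleGraph V}
    {H : SimpleGraph W} {r : V} {s : W} {D E : RootCount} (hD : HasRootCount G r D)
    (hE : HasRootCount H s E) :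
    HasRootCount (joinByEdge G H r s) (Sum.inl r) (D.join E) := by
  obtain ⟨m, hO, hI, hJ⟩ := hD
  obtain ⟨n, hO', hI', hJ'⟩ := hE
  have hT : TopCoeff (outPoly H s + isolPoly H s + pairPoly H s) (n + E.kind.pairExcess)
      E.total := by
    have h := ((hO'.of_le (Nat.le_add_right n E.kind.pairExcess)).add
      (hI'.of_le (n := n + E.kind.pairExcess) ?_)).add hJ'
    · convert h using 1
      rcases E with ⟨_ | _ | _, a, b, c⟩ <;> simp [RootCount.total, isolExcess, pairExcess]
    · rcases E with ⟨_ | _ | _, a, b, c⟩ <;> simp [isolExcess, pairExcess]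
  refine ⟨m + (n + E.kind.pairExcess), ?_, ?_, ?_⟩
  · rw [outPoly_joinByEdge]
    have := hO.mul hT
    rcases D with ⟨_ | _ | _, a, b, c⟩ <;> rcases E with ⟨_ | _ | _, a', b', c'⟩ <;> exact this
  · rw [isolPoly_joinByEdge]
    have h := (hI.mul hO').of_le
      (n := m + (n + E.kind.pairExcess) + (D.join E).kind.isolExcess) ?_
    · convert h using 1
      rcases D with ⟨_ | _ | _, a, b, c⟩ <;> rcases E with ⟨_ | _ | _, a', b', c'⟩ <;>
        simp only [RootCount.join, isolExcess, pairExcess] <;> grind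
    · rcases D with ⟨_ | _ | _, a, b, c⟩ <;> rcases E with ⟨_ | _ | _, a', b', c'⟩ <;>
        simp only [RootCount.join, isolExcess, pairExcess] <;> omega
  · rw [pairPoly_joinByEdge]
    have h := ((hJ.mul hO').of_le
      (n := m + (n + E.kind.pairExcess) + (D.join E).kind.pairExcess) ?_).add
      ((hI.mul hI').of_le (n := m + (n + E.kind.pairExcess) + (D.join E).kind.pairExcess) ?_)
    · convert h using 1
      rcases D with ⟨_ | _ | _, a, b, c⟩ <;> rcases E with ⟨_ | _ | _, a', b', c'⟩ <;>
        simp only [RootCount.join, isolExcess, pairExcess] <;> grind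
    all_goals
      rcases D with ⟨_ | _ | _, a, b, c⟩ <;> rcases E with ⟨_ | _ | _, a', b', c'⟩ <;>
        simp only [RootCount.join, isolExcess, pairExcess] <;> omega

/-! ### Rooted trees -/

/-- Rooted trees, built from the one-vertex tree by attaching the root of a tree to the root of
another one by an edge. -/
inductive GraftTree
  | leaf : GraftTree
  | graft : GraftTree → GraftTree → GraftTree

/-- The graph obtained by joining the distinguished vertices by an edge; the distinguished vertex
of the first graph remains distinguished. -/
def PointedGraph.graft (P Q : PointedGraph) : PointedGraph :=
  ⟨P.Vert ⊕ Q.Vert, joinByEdge P.graph Q.graph P.root Q.root, Sum.inl P.root⟩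

namespace GraftTree

/-- The pointed graph described by a rooted tree. -/
def toPointed : GraftTree → PointedGraph
  | leaf => ⟨Unit, ⊥, ()⟩
  | graft s t => s.toPointed.graft t.toPointed

/-- The number of vertices. -/
def size : GraftTree → ℕ
  | leaf => 1
  | graft s t => s.size + t.size

/-- The counts of the largest dissociation sets. -/
def count : GraftTree → RootCount
  | leaf => ⟨.isolated, 1, 1, 0⟩
  | graft s t => s.count.join t.count

end GraftTree

/-- Attach a list of rooted trees to the distinguished vertex of a graph. -/
def PointedGraph.attach (P : PointedGraph) (ts : List GraftTree) : PointedGraph :=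
  ts.foldl (fun Q t => Q.graft t.toPointed) P

/-- The pointed graph is finite, and its largest dissociation sets are counted by `D`. -/
def PointedGraph.Counted (P : PointedGraph) (n : ℕ) (D : RootCount) : Prop :=
  ∃ _ : Fintype P.Vert, Fintype.card P.Vert = n ∧ HasRootCount P.graph P.root D

theorem PointedGraph.Counted.graft {P Q : PointedGraph} {m n : ℕ} {D E : RootCount}
    (hP : P.Counted m D) (hQ : Q.Counted n E) : (P.graft Q).Counted (m + n) (D.join E) := by
  obtain ⟨i, hi, hD⟩ := hP
  obtain ⟨j, hj, hE⟩ := hQ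
  exact ⟨inferInstanceAs (Fintype (P.Vert ⊕ Q.Vert)), by rw [← hi, ← hj]; exact Fintype.card_sum,
    hD.joinByEdge hE⟩

theorem GraftTree.counted (t : GraftTree) : t.toPointed.Counted t.size t.count := by
  induction t with
  | leaf =>
    have hu : (Finset.univ : Finset (Finset Unit)) = {∅, {()}} := by decide
    refine ⟨inferInstanceAs (Fintype Unit), rfl, 0, ?_, ?_, ?_⟩
    · have : outPoly (⊥ : SimpleGraph Unit) () = 1 := by
        simp [outPoly, setPoly, hu, Dissociated]
      show TopCoeff (outPoly (⊥ : SimpleGraph Unit) ()) 0 1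
      rw [this]; simp [TopCoeff]
    · have : isolPoly (⊥ : SimpleGraph Unit) () = Polynomial.X := by
        simp [isolPoly, setPoly, hu, Dissociated, IsolatedFrom]
      show TopCoeff (isolPoly (⊥ : SimpleGraph Unit) ()) 1 1
      rw [this]; simp [TopCoeff]
    · have : pairPoly (⊥ : SimpleGraph Unit) () = 0 := by
        simp [pairPoly, setPoly, hu, Dissociated, IsolatedFrom]
      show TopCoeff (pairPoly (⊥ : SimpleGraph Unit) ()) 1 0
      rw [this]; simp [TopCoeff]
  | graft s t hs ht => exact hs.graft ht

/-- The counts after attaching a list of rooted trees. -/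
def RootCount.attach (D : RootCount) (ts : List GraftTree) : RootCount :=
  ts.foldl (fun D t => D.join t.count) D

theorem PointedGraph.Counted.attach {P : PointedGraph} {n : ℕ} {D : RootCount}
    (hP : P.Counted n D) (ts : List GraftTree) :
    (P.attach ts).Counted (n + (ts.map GraftTree.size).sum) (D.attach ts) := by
  induction ts generalizing P n D with
  | nil => simpa [PointedGraph.attach, RootCount.attach] using hP
  | cons t ts ih =>
    have := ih (hP.graft t.counted)
    simpa [PointedGraph.attach, RootCount.attach, add_assoc] using this

/-! ### From root counts to the number of maximum dissociation sets -/

section Maximum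

open Polynomial
open scoped Classical

variable {V : Type*} [Fintype V]

theorem coeff_setPoly (p : Finset V → Prop) (d : ℕ) :
    (setPoly p).coeff d = (Finset.univ.filter fun S => p S ∧ S.card = d).card := by
  rw [setPoly, finsetSum_coeff, Finset.card_filter]
  refine Finset.sum_congr rfl fun S _ => ?_
  by_cases h : p S <;> simp [h, coeff_X_pow, eq_comm]

/-- Positivity of `k` is essential: `TopCoeff` alone does not say that the degree `d` is attained.
-/
theorem numMaxDissociationSets_eq {G : SimpleGraph V} {d k : ℕ}
    (h : TopCoeff (setPoly (Dissociated G)) d k) (hk : 0 < k) :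
    numMaxDissociationSets G = k := by
  obtain ⟨h1, h2⟩ := h
  have hle : ∀ S, Dissociated G S → S.card ≤ d := by
    intro S hS
    refine (le_natDegree_of_ne_zero ?_).trans h1
    rw [coeff_setPoly]
    exact (Finset.card_pos.2 ⟨S, by simpa using hS⟩).ne'
  rw [coeff_setPoly] at h2
  obtain ⟨T, hT⟩ := Finset.card_pos.1 (h2.symm ▸ hk)
  simp only [Finset.mem_filter, Finset.mem_univ, true_and] at hT
  rw [numMaxDissociationSets, ← h2, ← Set.ncard_coe_finset]
  congr 1
  ext S
  simp only [Set.mem_ofPred_eq, Finset.coe_filter, Finset.mem_univ, true_and,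
    IsMaxDissociationSet, isDissociationSet_iff]
  constructor
  · rintro ⟨h3, h4⟩
    exact ⟨h3, le_antisymm (hle S h3) (hT.2 ▸ h4 T hT.1)⟩
  · rintro ⟨h3, h4⟩
    exact ⟨h3, fun U hU => h4 ▸ hle U hU⟩

theorem HasRootCount.numMaxDissociationSets_eq {G : SimpleGraph V} {r : V} {a b c : ℕ}
    (h : HasRootCount G r ⟨.free, a, b, c⟩) (ha : 0 < a) :
    numMaxDissociationSets G = a + b + c := by
  obtain ⟨e, hO, hI, hJ⟩ := h
  refine _root_.numMaxDissociationSets_eq (d := e) ?_ (by omega)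
  rw [setPoly_dissociated G r]
  exact (hO.add hI).add hJ

end Maximum

theorem numMaxDissociationSets_congr {V W : Type*} {G : SimpleGraph V} {H : SimpleGraph W}
    (e : G ≃g H) : numMaxDissociationSets G = numMaxDissociationSets H := by
  have key : ∀ S, IsDissociationSet H (S.map e.toEquiv.toEmbedding) ↔ IsDissociationSet G S := by
    intro S
    simp only [isDissociationSet_iff, Dissociated, Finset.forall_mem_map]
    simp [e.map_adj_iff]
  have hmax : ∀ S, IsMaxDissociationSet H (S.map e.toEquiv.toEmbedding) ↔
      IsMaxDissociationSet G S := by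
    intro S
    rw [IsMaxDissociationSet, IsMaxDissociationSet, key]
    refine and_congr_right fun _ => ⟨fun h T hT => ?_, fun h T hT => ?_⟩
    · simpa using h _ ((key T).2 hT)
    · obtain ⟨U, rfl⟩ : ∃ U, U.map e.toEquiv.toEmbedding = T :=
        ⟨T.map e.toEquiv.symm.toEmbedding, by ext; simp⟩
      simpa using h U ((key U).1 hT)
  rw [numMaxDissociationSets, numMaxDissociationSets]
  refine Set.ncard_congr (fun S _ => S.map e.toEquiv.toEmbedding) (fun S hS => (hmax S).2 hS)
    (fun S T _ _ h => Finset.map_injective _ h) fun T hT => ?_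
  obtain ⟨U, rfl⟩ : ∃ U, U.map e.toEquiv.toEmbedding = T :=
    ⟨T.map e.toEquiv.symm.toEmbedding, by ext; simp⟩
  exact ⟨U, (hmax U).1 hT, rfl⟩

/-! ### Bounds for the counts of rooted trees -/

/-- Upper bounds for the counts of a rooted tree of order `n`, relative to a power of `3`. -/
def RootCount.Bounded (n : ℕ) (D : RootCount) : Prop :=
  match D with
  | ⟨.isolated, a, b, c⟩ => (n = 1 ∧ a = 1 ∧ b = 1 ∧ c = 0) ∨
      (4 ≤ n ∧ ∃ e U, U = 3 ^ e ∧ 3 * e + 1 ≤ n ∧ a ≤ U ∧ 3 * b ≤ U ∧ 3 * c ≤ U ∧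
        a + 2 * b + c ≤ 2 * U ∧ (5 ≤ n → 9 * (a + 2 * b + c) ≤ 13 * U))
  | ⟨.matched, a, b, c⟩ => (n = 2 ∧ a = 1 ∧ b = 1 ∧ c = 1) ∨
      (5 ≤ n ∧ ∃ e U, U = 3 ^ e ∧ 3 * e + 2 ≤ n ∧ a ≤ U ∧ b ≤ U ∧ 3 * c ≤ U ∧
        a + b + c ≤ 2 * U ∧ (6 ≤ n → 9 * (a + b + c) ≤ 13 * U))
  | ⟨.free, a, b, c⟩ => (n = 3 ∧ a = 1 ∧ ((b = 1 ∧ c = 1) ∨ (b = 0 ∧ c = 2))) ∨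
      (4 ≤ n ∧ ∃ e U, U = 3 ^ e ∧ 3 * e + 3 ≤ n ∧ a ≤ U ∧ b ≤ U ∧ 3 * (a + b) ≤ 4 * U ∧
        a + b + c ≤ 2 * U ∧ (7 ≤ n → 9 * (a + b + c) ≤ 13 * U))

namespace RootCount

theorem products_nonneg (U W a b c a' b' c' : ℕ) : 0 ≤ U * W ∧ 0 ≤ a * a' ∧ 0 ≤ a * b' ∧
    0 ≤ a * c' ∧ 0 ≤ b * a' ∧ 0 ≤ b * b' ∧ 0 ≤ c * a' ∧ 0 ≤ U * a' :=
  ⟨Nat.zero_le _, Nat.zero_le _, Nat.zero_le _, Nat.zero_le _, Nat.zero_le _, Nat.zero_le _,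
    Nat.zero_le _, Nat.zero_le _⟩

/-- In each join lemma of this kind either tree may be a small exception or satisfy the general
inequalities. When both are general, their inequalities are multiplied and the goal becomes linear
in the resulting monomials. The exponent gains one when the attached tree is free, because its order
is at least 3f + 3. -/
theorem bounded_join_isolated_free {m n a b c a' b' c' : ℕ}
    (hD : Bounded m ⟨.isolated, a, b, c⟩) (hE : Bounded n ⟨.free, a', b', c'⟩) :
    Bounded (m + n) (join ⟨.isolated, a, b, c⟩ ⟨.free, a', b', c'⟩) := by
  simp only [Bounded, join, total] at hD hE ⊢
  obtain ⟨rfl, rfl, rfl, rfl⟩ | ⟨hm, e, U, hU, he, h1, h2, h3, h4, h5⟩ := hD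
  · obtain ⟨rfl, rfl, h⟩ | ⟨hn, f, W, hW, hf, k1, k2, k3, k4, k5⟩ := hE
    · exact Or.inr ⟨by omega, 1, 3, by norm_num, by omega, by omega, by omega, by omega, by omega,
        by omega⟩
    · exact Or.inr ⟨by omega, f + 1, 3 * W, by rw [hW]; ring, by omega, by omega, by omega,
        by omega, by omega, by omega⟩
  · obtain ⟨rfl, rfl, h⟩ | ⟨hn, f, W, hW, hf, k1, k2, k3, k4, k5⟩ := hE
    · obtain ⟨rfl, rfl⟩ | ⟨rfl, rfl⟩ := h <;>
      exact Or.inr ⟨by omega, e + 1, 3 * U, by rw [hU]; ring, by omega, by omega, by omega,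
        by omega, by omega, by omega⟩
    · have p1 := Nat.mul_le_mul h1 k4
      have p2 := Nat.mul_le_mul h2 k1
      have p3 := Nat.mul_le_mul h3 k1
      have p4 := Nat.mul_le_mul h2 k2
      have z := products_nonneg U W a b c a' b' c'
      obtain ⟨z0, z1, z2, z3, z4, z5, z6, z7⟩ := z
      exact Or.inr ⟨by omega, e + f + 1, 3 * (U * W), by rw [hU, hW]; ring, by omega,
        by linarith, by linarith, by linarith, by linarith, fun _ => by linarith⟩

theorem bounded_join_isolated_isolated {m n a b c a' b' c' : ℕ}
    (hD : Bounded m ⟨.isolated, a, b, c⟩) (hE : Bounded n ⟨.isolated, a', b', c'⟩) :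
    Bounded (m + n) (join ⟨.isolated, a, b, c⟩ ⟨.isolated, a', b', c'⟩) := by
  simp only [Bounded, join, total] at hD hE ⊢
  obtain ⟨rfl, rfl, rfl, rfl⟩ | ⟨hm, e, U, hU, he, h1, h2, h3, h4, h5⟩ := hD
  · obtain ⟨rfl, rfl, rfl, rfl⟩ | ⟨hn, f, W, hW, hf, k1, k2, k3, k4, k5⟩ := hE
    · exact Or.inl (by norm_num)
    · exact Or.inr ⟨by omega, f, W, hW, by omega, by omega, by omega, by omega, by omega,
        by omega⟩
  · obtain ⟨rfl, rfl, rfl, rfl⟩ | ⟨hn, f, W, hW, hf, k1, k2, k3, k4, k5⟩ := hE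
    · exact Or.inr ⟨by omega, e, U, hU, by omega, by omega, by omega, by omega, by omega,
        by omega⟩
    · have p1 := Nat.mul_le_mul h1 (Nat.add_le_add k2 k3)
      have p2 := Nat.mul_le_mul h2 k1
      have p3 := Nat.mul_le_mul h2 k2
      have z := products_nonneg U W a b c a' b' c'
      obtain ⟨z0, z1, z2, z3, z4, z5, z6, z7⟩ := z
      exact Or.inr ⟨by omega, e + f, U * W, by rw [hU, hW]; ring, by omega,
        by linarith, by linarith, by linarith, by linarith, fun _ => by linarith⟩

theorem bounded_join_isolated_matched {m n a b c a' b' c' : ℕ}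
    (hD : Bounded m ⟨.isolated, a, b, c⟩) (hE : Bounded n ⟨.matched, a', b', c'⟩) :
    Bounded (m + n) (join ⟨.isolated, a, b, c⟩ ⟨.matched, a', b', c'⟩) := by
  simp only [Bounded, join, total] at hD hE ⊢
  obtain ⟨rfl, rfl, rfl, rfl⟩ | ⟨hm, e, U, hU, he, h1, h2, h3, h4, h5⟩ := hD
  · obtain ⟨rfl, rfl, rfl, rfl⟩ | ⟨hn, f, W, hW, hf, k1, k2, k3, k4, k5⟩ := hE
    · exact Or.inl (by norm_num)
    · exact Or.inr ⟨by omega, f, W, hW, by omega, by omega, by omega, by omega, by omega,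
        by omega⟩
  · obtain ⟨rfl, rfl, rfl, rfl⟩ | ⟨hn, f, W, hW, hf, k1, k2, k3, k4, k5⟩ := hE
    · exact Or.inr ⟨by omega, e, U, hU, by omega, by omega, by omega, by omega, by omega,
        by omega⟩
    · have p1 := Nat.mul_le_mul h1 k3
      have p2 := Nat.mul_le_mul h2 k1
      have p3 := Nat.mul_le_mul h3 k1
      have p4 := Nat.mul_le_mul h2 k2
      have z := products_nonneg U W a b c a' b' c'
      obtain ⟨z0, z1, z2, z3, z4, z5, z6, z7⟩ := z
      exact Or.inr ⟨by omega, e + f, U * W, by rw [hU, hW]; ring, by omega,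
        by linarith, by linarith, by linarith, by linarith, fun _ => by linarith⟩

theorem bounded_join_matched_free {m n a b c a' b' c' : ℕ}
    (hD : Bounded m ⟨.matched, a, b, c⟩) (hE : Bounded n ⟨.free, a', b', c'⟩) :
    Bounded (m + n) (join ⟨.matched, a, b, c⟩ ⟨.free, a', b', c'⟩) := by
  simp only [Bounded, join, total] at hD hE ⊢
  obtain ⟨rfl, rfl, rfl, rfl⟩ | ⟨hm, e, U, hU, he, h1, h2, h3, h4, h5⟩ := hD
  · obtain ⟨rfl, rfl, h⟩ | ⟨hn, f, W, hW, hf, k1, k2, k3, k4, k5⟩ := hE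
    · exact Or.inr ⟨by omega, 1, 3, by norm_num, by omega, by omega, by omega, by omega, by omega,
        by omega⟩
    · exact Or.inr ⟨by omega, f + 1, 3 * W, by rw [hW]; ring, by omega, by omega, by omega,
        by omega, by omega, by omega⟩
  · obtain ⟨rfl, rfl, h⟩ | ⟨hn, f, W, hW, hf, k1, k2, k3, k4, k5⟩ := hE
    · have h' : 1 + b' + c' = 3 := by omega
      rw [h']
      exact Or.inr ⟨by omega, e + 1, 3 * U, by rw [hU]; ring, by omega, by omega, by omega,
        by omega, by omega, by omega⟩
    · have p1 := Nat.mul_le_mul h1 k4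
      have p2 := Nat.mul_le_mul h2 k1
      have p3 := Nat.mul_le_mul h3 k1
      have z := products_nonneg U W a b c a' b' c'
      obtain ⟨z0, z1, z2, z3, z4, z5, z6, z7⟩ := z
      exact Or.inr ⟨by omega, e + f + 1, 3 * (U * W), by rw [hU, hW]; ring, by omega,
        by linarith, by linarith, by linarith, by linarith, fun _ => by linarith⟩

theorem bounded_join_matched_isolated {m n a b c a' b' c' : ℕ}
    (hD : Bounded m ⟨.matched, a, b, c⟩) (hE : Bounded n ⟨.isolated, a', b', c'⟩) :
    Bounded (m + n) (join ⟨.matched, a, b, c⟩ ⟨.isolated, a', b', c'⟩) := by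
  simp only [Bounded, join, total] at hD hE ⊢
  obtain ⟨rfl, rfl, rfl, rfl⟩ | ⟨hm, e, U, hU, he, h1, h2, h3, h4, h5⟩ := hD
  · obtain ⟨rfl, rfl, rfl, rfl⟩ | ⟨hn, f, W, hW, hf, k1, k2, k3, k4, k5⟩ := hE
    · exact Or.inl (by norm_num)
    · exact Or.inr ⟨by omega, f, W, hW, by omega, by omega, by omega, by omega, by omega,
        by omega⟩
  · obtain ⟨rfl, rfl, rfl, rfl⟩ | ⟨hn, f, W, hW, hf, k1, k2, k3, k4, k5⟩ := hE
    · exact Or.inr ⟨by omega, e, U, hU, by omega, by omega, by omega, by omega, by omega,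
        by omega⟩
    · have p1 := Nat.mul_le_mul h1 (Nat.add_le_add k2 k3)
      have p2 := Nat.mul_le_mul h3 k1
      have p3 := Nat.mul_le_mul h2 k2
      have z := products_nonneg U W a b c a' b' c'
      obtain ⟨z0, z1, z2, z3, z4, z5, z6, z7⟩ := z
      exact Or.inr ⟨by omega, e + f, U * W, by rw [hU, hW]; ring, by omega,
        by linarith, by positivity, by linarith, by linarith, fun _ => by linarith⟩

theorem bounded_join_matched_matched {m n a b c a' b' c' : ℕ}
    (hD : Bounded m ⟨.matched, a, b, c⟩) (hE : Bounded n ⟨.matched, a', b', c'⟩) :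
    Bounded (m + n) (join ⟨.matched, a, b, c⟩ ⟨.matched, a', b', c'⟩) := by
  simp only [Bounded, join, total] at hD hE ⊢
  obtain ⟨rfl, rfl, rfl, rfl⟩ | ⟨hm, e, U, hU, he, h1, h2, h3, h4, h5⟩ := hD
  · obtain ⟨rfl, rfl, rfl, rfl⟩ | ⟨hn, f, W, hW, hf, k1, k2, k3, k4, k5⟩ := hE
    · exact Or.inr ⟨by omega, 0, 1, by norm_num, by omega, by omega, by omega, by omega, by omega,
        by omega⟩
    · exact Or.inr ⟨by omega, f, W, hW, by omega, by omega, by omega, by omega, by omega,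
        by omega⟩
  · obtain ⟨rfl, rfl, rfl, rfl⟩ | ⟨hn, f, W, hW, hf, k1, k2, k3, k4, k5⟩ := hE
    · exact Or.inr ⟨by omega, e, U, hU, by omega, by omega, by omega, by omega, by omega,
        by omega⟩
    · have p1 := Nat.mul_le_mul h1 k3
      have p2 := Nat.mul_le_mul h3 k1
      have z := products_nonneg U W a b c a' b' c'
      obtain ⟨z0, z1, z2, z3, z4, z5, z6, z7⟩ := z
      exact Or.inr ⟨by omega, e + f, U * W, by rw [hU, hW]; ring, by omega,
        by linarith, by positivity, by linarith, by linarith, fun _ => by linarith⟩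

theorem bounded_join_free_free {m n a b c a' b' c' : ℕ}
    (hD : Bounded m ⟨.free, a, b, c⟩) (hE : Bounded n ⟨.free, a', b', c'⟩) :
    Bounded (m + n) (join ⟨.free, a, b, c⟩ ⟨.free, a', b', c'⟩) := by
  simp only [Bounded, join, total] at hD hE ⊢
  obtain ⟨rfl, rfl, h⟩ | ⟨hm, e, U, hU, he, h1, h2, h3, h4, h5⟩ := hD
  · obtain ⟨rfl, rfl, h'⟩ | ⟨hn, f, W, hW, hf, k1, k2, k3, k4, k5⟩ := hE
    · obtain ⟨rfl, rfl⟩ | ⟨rfl, rfl⟩ := h <;>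
      exact Or.inr ⟨by omega, 1, 3, by norm_num, by omega, by omega, by omega, by omega, by omega,
        by omega⟩
    · obtain ⟨rfl, rfl⟩ | ⟨rfl, rfl⟩ := h <;>
      exact Or.inr ⟨by omega, f + 1, 3 * W, by rw [hW]; ring, by omega, by omega, by omega,
        by omega, by omega, by omega⟩
  · obtain ⟨rfl, rfl, h⟩ | ⟨hn, f, W, hW, hf, k1, k2, k3, k4, k5⟩ := hE
    · obtain ⟨rfl, rfl⟩ | ⟨rfl, rfl⟩ := h <;>
      exact Or.inr ⟨by omega, e + 1, 3 * U, by rw [hU]; ring, by omega, by omega, by omega,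
        by omega, by omega, by omega⟩
    · have p1 := Nat.mul_le_mul h1 k4
      have p2 := Nat.mul_le_mul h2 k1
      -- The new sum is a(b'+c') + (a+b+c)a' + bb' ≤ U((a'+b'+c') + (a'+b')) ≤ (10/3)UW, below the
      -- required (13/9)·3UW. The last estimate uses 3(a'+b') ≤ 4W.
      have p3 := Nat.mul_le_mul_right (b' + c') h1
      have p4 := Nat.mul_le_mul_right a' h4
      have p5 := Nat.mul_le_mul_right b' h2
      have p6 := Nat.mul_le_mul_left U k4
      have p7 := Nat.mul_le_mul_left U k3
      have z := products_nonneg U W a b c a' b' c'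
      obtain ⟨z0, z1, z2, z3, z4, z5, z6, z7⟩ := z
      exact Or.inr ⟨by omega, e + f + 1, 3 * (U * W), by rw [hU, hW]; ring, by omega,
        by linarith, by linarith, by linarith, by linarith, fun _ => by linarith⟩

theorem bounded_join_free_isolated {m n a b c a' b' c' : ℕ}
    (hD : Bounded m ⟨.free, a, b, c⟩) (hE : Bounded n ⟨.isolated, a', b', c'⟩) :
    Bounded (m + n) (join ⟨.free, a, b, c⟩ ⟨.isolated, a', b', c'⟩) := by
  simp only [Bounded, join, total] at hD hE ⊢
  obtain ⟨rfl, rfl, h⟩ | ⟨hm, e, U, hU, he, h1, h2, h3, h4, h5⟩ := hD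
  · obtain ⟨rfl, rfl, rfl, rfl⟩ | ⟨hn, f, W, hW, hf, k1, k2, k3, k4, k5⟩ := hE
    · exact Or.inr ⟨by omega, 0, 1, by norm_num, by omega, by omega, by omega, by omega, by omega,
        by omega⟩
    · obtain ⟨rfl, rfl⟩ | ⟨rfl, rfl⟩ := h <;>
      exact Or.inr ⟨by omega, f, W, hW, by omega, by omega, by omega, by omega, by omega,
        by omega⟩
  · obtain ⟨rfl, rfl, rfl, rfl⟩ | ⟨hn, f, W, hW, hf, k1, k2, k3, k4, k5⟩ := hE
    · exact Or.inr ⟨by omega, e, U, hU, by omega, by omega, by omega, by omega, by omega,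
        by omega⟩
    · have p1 := Nat.mul_le_mul h1 (Nat.add_le_add k2 k3)
      have p3 := Nat.mul_le_mul h2 k2
      have z := products_nonneg U W a b c a' b' c'
      obtain ⟨z0, z1, z2, z3, z4, z5, z6, z7⟩ := z
      exact Or.inr ⟨by omega, e + f, U * W, by rw [hU, hW]; ring, by omega,
        by linarith, by positivity, by linarith, by linarith, fun _ => by linarith⟩

/-- Every set using the root becomes too small here, so only the bounds on `a` and `c'` matter. -/
theorem bounded_join_free_matched {m n a b c a' b' c' : ℕ}
    (hD : Bounded m ⟨.free, a, b, c⟩) (hE : Bounded n ⟨.matched, a', b', c'⟩) :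
    Bounded (m + n) (join ⟨.free, a, b, c⟩ ⟨.matched, a', b', c'⟩) := by
  simp only [Bounded, join, total] at hD hE ⊢
  have hD' : 3 ≤ m ∧ ∃ e U, U = 3 ^ e ∧ 3 * e + 3 ≤ m ∧ a ≤ U := by
    obtain ⟨rfl, rfl, h⟩ | ⟨hm, e, U, hU, he, h1, h2, h3, h4, h5⟩ := hD
    · exact ⟨le_rfl, 0, 1, by norm_num⟩
    · exact ⟨by omega, e, U, hU, he, h1⟩
  have hE' : 2 ≤ n ∧ ∃ e U, U = 3 ^ e ∧ 3 * e + 2 ≤ n ∧ c' ≤ U := by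
    obtain ⟨rfl, rfl, rfl, rfl⟩ | ⟨hn, f, W, hW, hf, k1, k2, k3, k4, k5⟩ := hE
    · exact ⟨le_rfl, 0, 1, by norm_num⟩
    · exact ⟨by omega, f, W, hW, hf, by omega⟩
  obtain ⟨hm, e, U, hU, he, h⟩ := hD'
  obtain ⟨hn, f, W, hW, hf, k⟩ := hE'
  have p1 := Nat.mul_le_mul h k
  have z := products_nonneg U W a b c a' b' c'
  obtain ⟨z0, z1, z2, z3, z4, z5, z6, z7⟩ := z
  exact Or.inr ⟨by omega, e + f, U * W, by rw [hU, hW]; ring, by omega,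
    by linarith, by positivity, by linarith, by linarith, fun _ => by linarith⟩

/-- The constants are tight on small trees. The factor 2 is reached by P_4 rooted at an end, with
counts (3, 1, 1), and by the free tree (3, 1, 2) of order 6. The factor 13/9 is reached by (9, 1,
3), the tree of order 9 with one `path2` and two `path3` at the root. For isolated roots the sum a +
2b + c is controlled because it becomes a + b + c once the tree is attached to a single vertex. -/
theorem Bounded.join {m n : ℕ} {D E : RootCount} (hD : D.Bounded m) (hE : E.Bounded n) :
    (D.join E).Bounded (m + n) := by
  rcases D with ⟨_ | _ | _, a, b, c⟩ <;> rcases E with ⟨_ | _ | _, a', b', c'⟩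
  · exact bounded_join_isolated_isolated hD hE
  · exact bounded_join_isolated_matched hD hE
  · exact bounded_join_isolated_free hD hE
  · exact bounded_join_matched_isolated hD hE
  · exact bounded_join_matched_matched hD hE
  · exact bounded_join_matched_free hD hE
  · exact bounded_join_free_isolated hD hE
  · exact bounded_join_free_matched hD hE
  · exact bounded_join_free_free hD hE

end RootCount

theorem GraftTree.bounded (t : GraftTree) : t.count.Bounded t.size := by
  induction t with
  | leaf => exact Or.inl ⟨rfl, rfl, rfl, rfl⟩
  | graft s t hs ht => exact hs.join ht

/-! ### Rooted trees with many maximum dissociation sets -/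

/-- Trees whose root has this status have total count at most `3 ^ ((n - k) / 3)`, where `k` is
the `totalLoss`. -/
def RootKind.totalLoss : RootKind → ℕ
  | isolated => 1 | matched => 2 | free => 0

/-- Trees whose root has this status have at most `3 ^ ((n - k) / 3)` largest dissociation sets
avoiding the root, where `k` is the `outLoss`. -/
def RootKind.outLoss : RootKind → ℕ
  | isolated => 1 | matched => 2 | free => 3

namespace RootCount

theorem Bounded.exists_out_le {n : ℕ} {D : RootCount} (h : D.Bounded n) :
    ∃ e, 3 * e + D.kind.outLoss ≤ n ∧ D.out ≤ 3 ^ e := by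
  rcases D with ⟨_ | _ | _, a, b, c⟩ <;>
    simp only [Bounded, RootKind.outLoss] at h ⊢ <;>
    obtain h | ⟨-, e, U, rfl, h1, h2, -⟩ := h
  all_goals first
    | exact ⟨e, h1, h2⟩
    | exact ⟨0, by omega, by simp; omega⟩

/-- The factor 2/3 is the price of an order above three. For free roots the exponent rises by one:
the total may reach 2·3^e, which is two thirds of 3^(e+1). -/
theorem Bounded.exists_total_le {n : ℕ} {D : RootCount} (h : D.Bounded n) :
    ∃ e, 3 * e + D.kind.totalLoss ≤ n ∧ D.total ≤ 3 ^ e ∧ (4 ≤ n → 3 * D.total ≤ 2 * 3 ^ e) := by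
  rcases D with ⟨_ | _ | _, a, b, c⟩ <;>
    simp only [Bounded, RootKind.totalLoss, total] at h ⊢
  · obtain h | ⟨-, e, U, rfl, h⟩ := h
    · exact ⟨0, by omega, by simp; omega, by omega⟩
    · exact ⟨e, by omega, by omega, by omega⟩
  · obtain h | ⟨-, e, U, rfl, h⟩ := h
    · exact ⟨0, by omega, by simp; omega, by omega⟩
    · exact ⟨e, by omega, by omega, by omega⟩
  · obtain h | ⟨-, e, U, rfl, h⟩ := h
    · exact ⟨1, by omega, by omega, by omega⟩
    · exact ⟨e + 1, by omega, by omega, by omega⟩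

theorem join_out (D E : RootCount) : (D.join E).out = D.out * E.total := by
  rcases D with ⟨_ | _ | _, a, b, c⟩ <;> rcases E with ⟨_ | _ | _, a', b', c'⟩ <;> rfl

theorem outLoss_join_le (D E : RootCount) :
    (D.join E).kind.outLoss ≤ D.kind.outLoss + E.kind.totalLoss := by
  rcases D with ⟨_ | _ | _, a, b, c⟩ <;> rcases E with ⟨_ | _ | _, a', b', c'⟩ <;>
    simp [join, RootKind.outLoss, RootKind.totalLoss]

/-- This makes the counts depend on the branches only up to permutation. -/
theorem join_right_comm (D E F : RootCount) : (D.join E).join F = (D.join F).join E := by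
  rcases D with ⟨_ | _ | _, a, b, c⟩ <;> rcases E with ⟨_ | _ | _, a', b', c'⟩ <;>
    rcases F with ⟨_ | _ | _, a'', b'', c''⟩ <;>
    simp only [join, total, mk.injEq, true_and] <;> constructorm* _ ∧ _ <;> first | trivial | ring

theorem attach_perm (D : RootCount) {L M : List GraftTree} (h : L.Perm M) :
    D.attach L = D.attach M :=
  haveI : RightCommutative fun (D : RootCount) (t : GraftTree) => D.join t.count :=
    ⟨fun _ _ _ => join_right_comm _ _ _⟩
  h.foldl_eq D

theorem attach_append (D : RootCount) (L M : List GraftTree) :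
    D.attach (L ++ M) = (D.attach L).attach M := by
  simp [attach]

@[simp] theorem attach_cons (D : RootCount) (t : GraftTree) (L : List GraftTree) :
    D.attach (t :: L) = (D.join t.count).attach L := rfl

@[simp] theorem attach_nil (D : RootCount) : D.attach [] = D := rfl

end RootCount

namespace GraftTree

/-- The branches at the root. -/
def children : GraftTree → List GraftTree
  | leaf => []
  | graft s t => s.children ++ [t]

/-- The tree with the given branches at the root. -/
def ofChildren (L : List GraftTree) : GraftTree := L.foldl graft leaf

/-- The path of order `2`. -/
abbrev path2 : GraftTree := graft leaf leaf

/-- The path of order `3`, rooted at an end vertex. -/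
abbrev path3 : GraftTree := graft leaf path2

/-- The path of order `3`, rooted at its inner vertex. -/
abbrev cherry : GraftTree := graft path2 leaf

theorem count_eq_attach (t : GraftTree) : t.count = leaf.count.attach t.children := by
  induction t with
  | leaf => rfl
  | graft s t hs _ => rw [children, RootCount.attach_append, ← hs]; rfl

theorem toPointed_eq_attach (t : GraftTree) :
    t.toPointed = leaf.toPointed.attach t.children := by
  induction t with
  | leaf => rfl
  | graft s t hs _ =>
    rw [children, PointedGraph.attach, List.foldl_append]
    rw [PointedGraph.attach] at hs
    rw [← hs]
    rfl

theorem size_eq_children (t : GraftTree) : t.size = 1 + (t.children.map size).sum := by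
  induction t with
  | leaf => rfl
  | graft s t hs _ => simp [children, size, hs, add_assoc]

theorem size_pos (t : GraftTree) : 0 < t.size := by
  rw [size_eq_children]; omega

/-- Positivity of `out` needs positive branch totals, hence positivity of `isol` or `pair` whenever
the branch root lies in every maximum set. -/
theorem count_pos (t : GraftTree) : 0 < t.count.out ∧ (t.count.kind ≠ .free → 0 < t.count.isol) ∧
    (t.count.kind = .matched → 0 < t.count.pair) := by
  have key : ∀ D : RootCount, (0 < D.out ∧ (D.kind ≠ .free → 0 < D.isol) ∧
      (D.kind = .matched → 0 < D.pair)) → 0 < D.total := by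
    rintro ⟨_ | _ | _, a, b, c⟩ h <;> simp [RootCount.total] at h ⊢ <;> omega
  induction t with
  | leaf => simp [count]
  | graft s t hs ht =>
    have h := key _ ht
    rw [count]
    refine ⟨by rw [RootCount.join_out]; exact Nat.mul_pos hs.1 h, ?_⟩
    clear h
    generalize s.count = D at *
    generalize t.count = E at *
    rcases D with ⟨_ | _ | _, a, b, c⟩ <;> rcases E with ⟨_ | _ | _, a', b', c'⟩ <;>
      simp_all [RootCount.join]

/-- Sets avoiding the root restrict independently to the branches, so `out` is the product of the
branch totals, and one branch of order at least four costs a factor 2/3. -/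
theorem exists_out_le_of_large_child (t : GraftTree) : (∀ c ∈ t.children, c.size ≤ 3) ∨
    ∃ e, 3 * e + t.count.kind.outLoss ≤ t.size ∧ 3 * t.count.out ≤ 2 * 3 ^ e := by
  induction t with
  | leaf => simp [children]
  | graft s t hs _ =>
    have hk := RootCount.outLoss_join_le s.count t.count
    obtain ⟨e, he, h1⟩ := s.bounded.exists_out_le
    obtain ⟨f, hf, h2, h3⟩ := t.bounded.exists_total_le
    rw [count, RootCount.join_out]
    rcases le_or_gt t.size 3 with ht | ht
    · obtain hs | ⟨e, he, h1⟩ := hs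
      · left
        intro c hc
        rw [children, List.mem_append, List.mem_singleton] at hc
        obtain hc | rfl := hc
        · exact hs c hc
        · exact ht
      · refine Or.inr ⟨e + f, by rw [size]; omega, ?_⟩
        have := Nat.mul_le_mul h1 h2
        rw [pow_add]
        linarith
    · refine Or.inr ⟨e + f, by rw [size]; omega, ?_⟩
      have := Nat.mul_le_mul h1 (h3 ht)
      rw [pow_add]
      linarith

theorem eq_of_size_le_three {t : GraftTree} (h : t.size ≤ 3) :
    t = leaf ∨ t = path2 ∨ t = path3 ∨ t = cherry := by
  have pos := size_pos
  rcases t with _ | ⟨_ | ⟨s, s'⟩, _ | ⟨t, t'⟩⟩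
  · simp
  · simp
  · have := pos t; have := pos t'
    simp only [size] at h
    rcases t with _ | ⟨a, b⟩
    · rcases t' with _ | ⟨a', b'⟩
      · simp
      · have := pos a'; have := pos b'
        simp only [size] at h; omega
    · have := pos a; have := pos b
      simp only [size] at h; omega
  · have := pos s; have := pos s'
    simp only [size] at h
    rcases s with _ | ⟨a, b⟩
    · rcases s' with _ | ⟨a', b'⟩
      · simp
      · have := pos a'; have := pos b'
        simp only [size] at h; omega
    · have := pos a; have := pos b
      simp only [size] at h; omega
  · have := pos s; have := pos s'; have := pos t; have := pos t'
    simp only [size] at h; omega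

/-- Every member is a path of order `3`. -/
def AllOrder3 (M : List GraftTree) : Prop := ∀ t ∈ M, t = path3 ∨ t = cherry

open List in
theorem exists_perm_of_size_le_three (L : List GraftTree) (h : ∀ t ∈ L, t.size ≤ 3) :
    ∃ i j M, AllOrder3 M ∧ L.Perm (replicate i leaf ++ (replicate j path2 ++ M)) := by
  induction L with
  | nil => exact ⟨0, 0, [], by simp [AllOrder3], by simp⟩
  | cons t L ih =>
    obtain ⟨i, j, M, hM, hL⟩ := ih fun s hs => h s (mem_cons_of_mem _ hs)
    rcases eq_of_size_le_three (h t mem_cons_self) with rfl | rfl | h3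
    · exact ⟨i + 1, j, M, hM, by simpa [replicate_succ] using hL⟩
    · refine ⟨i, j + 1, M, hM, ((hL.cons _).trans perm_middle.symm).trans ?_⟩
      simp [replicate_succ]
    · refine ⟨i, j, t :: M, ?_, ((hL.cons _).trans perm_middle.symm).trans ?_⟩
      · intro s hs
        rcases mem_cons.1 hs with rfl | hs
        · exact h3
        · exact hM s hs
      · exact Perm.append_left _ perm_middle.symm

theorem sum_size_of_allOrder3 {M : List GraftTree} (hM : AllOrder3 M) :
    (M.map size).sum = 3 * M.length := by
  induction M with
  | nil => rfl
  | cons t M ih =>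
    have h := ih fun s hs => hM s (List.mem_cons_of_mem _ hs)
    rcases hM t List.mem_cons_self with rfl | rfl <;> simp [size, h] <;> ring

end GraftTree

open GraftTree

/-- Here `p` is the number of `path3` in `M`. A `path3` has one largest set with isolated root and a
`cherry` has none, so only the paths offer a partner to an isolated root; either kind triples `out`.
-/
theorem RootCount.exists_attach_allOrder3 {M : List GraftTree} (hM : AllOrder3 M) :
    ∃ p ≤ M.length, (p = M.length → M = List.replicate M.length path3) ∧
      (M = List.replicate M.length path3 → p = M.length) ∧ ∀ a b c,
        RootCount.attach ⟨.free, a, b, c⟩ M = ⟨.free, 3 ^ M.length * a, b, c + b * p⟩ := by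
  induction M with
  | nil => simp
  | cons t M ih =>
    obtain ⟨p, hp, h1, h2, h3⟩ := ih fun s hs => hM s (List.mem_cons_of_mem _ hs)
    rcases hM t List.mem_cons_self with rfl | rfl
    · refine ⟨p + 1, by simpa using hp, fun h => ?_, fun h => ?_, fun a b c => ?_⟩
      · rw [List.length_cons, List.replicate_succ, ← h1 (by simpa using h)]
      · simp [List.replicate_succ] at h
        simp [h2 h]
      · simp [count, RootCount.join, RootCount.total, h3]
        constructor <;> ring
    · refine ⟨p, by simp; omega, fun h => ?_, fun h => ?_, fun a b c => ?_⟩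
      · simp at h; omega
      · simp [List.replicate_succ] at h
      · simp [count, RootCount.join, RootCount.total, h3]
        ring

theorem RootCount.kind_attach_allOrder3 {M : List GraftTree} (hM : AllOrder3 M) (D : RootCount) :
    (D.attach M).kind = D.kind := by
  induction M generalizing D with
  | nil => rfl
  | cons t M ih =>
    rw [attach_cons, ih fun s hs => hM s (List.mem_cons_of_mem _ hs)]
    rcases D with ⟨_ | _ | _, a, b, c⟩ <;>
      rcases hM t List.mem_cons_self with rfl | rfl <;> rfl

theorem RootCount.attach_replicate_of_isol_eq_zero (a i j : ℕ) :
    RootCount.attach ⟨.free, a, 0, 0⟩ (List.replicate i leaf ++ List.replicate j path2) =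
      ⟨.free, a, 0, 0⟩ := by
  induction i with
  | zero =>
    induction j with
    | zero => rfl
    | succ j ih =>
      rw [List.replicate_zero, List.nil_append] at ih ⊢
      rw [List.replicate_succ, attach_cons, ← ih]
      simp [count, join, total, ih]
  | succ i ih =>
    rw [List.replicate_succ, List.cons_append, attach_cons]
    simpa [count, join, total] using ih

/-- The pairs (i, j) = (0, 0) and (1, 0) give isolated and matched roots and are excluded by `hf`;
branches of order three do not change the kind. Only for (0, 1) does an isolated root survive among
the largest sets, so only then do the branches of order three contribute further partners. -/
theorem GraftTree.count_of_perm {t : GraftTree} {i j : ℕ} {M : List GraftTree}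
    (hM : AllOrder3 M)
    (h : t.children.Perm (List.replicate i leaf ++ (List.replicate j path2 ++ M)))
    (hf : t.count.kind = .free) :
    (i = 0 ∧ j = 1 ∧ ∃ p ≤ M.length, (p = M.length ↔ M = List.replicate M.length path3) ∧
      t.count = ⟨.free, 3 ^ M.length, 1, 1 + p⟩) ∨
    (i = 2 ∧ j = 0 ∧ t.count = ⟨.free, 3 ^ M.length, 0, 2⟩) ∨
    (i = 1 ∧ j = 1 ∧ t.count = ⟨.free, 3 ^ M.length, 0, 1⟩) ∨
    (3 ≤ i + 2 * j ∧ ¬ (i = 1 ∧ j = 1) ∧ t.count = ⟨.free, 3 ^ M.length, 0, 0⟩) := by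
  rw [count_eq_attach, RootCount.attach_perm _ h, ← List.append_assoc,
    RootCount.attach_append] at hf ⊢
  rw [RootCount.kind_attach_allOrder3 hM] at hf
  obtain ⟨p, hp, h1, h2, h3⟩ := RootCount.exists_attach_allOrder3 hM
  have h0 := RootCount.attach_replicate_of_isol_eq_zero 1
  rcases i with _ | _ | _ | i
  · rcases j with _ | _ | j
    · simp [count] at hf
    · refine Or.inl ⟨rfl, rfl, p, hp, ⟨h1, h2⟩, ?_⟩
      simp [count, RootCount.join, RootCount.total, h3]
    · refine Or.inr (Or.inr (Or.inr ⟨by omega, by omega, ?_⟩))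
      have := h0 0 j
      simp [List.replicate_succ, count, RootCount.join, RootCount.total] at this ⊢
      simp [this, h3]
  · rcases j with _ | _ | j
    · simp [count, RootCount.join] at hf
    · refine Or.inr (Or.inr (Or.inl ⟨rfl, rfl, ?_⟩))
      simp [count, RootCount.join, RootCount.total, h3]
    · refine Or.inr (Or.inr (Or.inr ⟨by omega, by omega, ?_⟩))
      have := h0 0 j
      simp [List.replicate_succ, count, RootCount.join, RootCount.total] at this ⊢
      simp [this, h3]
  · rcases j with _ | j
    · refine Or.inr (Or.inl ⟨rfl, rfl, ?_⟩)
      simp [List.replicate_succ, count, RootCount.join, RootCount.total, h3]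
    · refine Or.inr (Or.inr (Or.inr ⟨by omega, by omega, ?_⟩))
      have := h0 0 j
      simp [List.replicate_succ, count, RootCount.join, RootCount.total] at this ⊢
      simp [this, h3]
  · refine Or.inr (Or.inr (Or.inr ⟨by omega, by omega, ?_⟩))
    have := h0 i j
    simp [List.replicate_succ, count, RootCount.join, RootCount.total] at this ⊢
    simp [this, h3]

/-! ### The extremal problem for lists of rooted trees -/

theorem GraftTree.total_pos (t : GraftTree) : 0 < t.count.total := by
  have h := t.count_pos
  generalize t.count = D at h
  rcases D with ⟨_ | _ | _, a, b, c⟩ <;> simp [RootCount.total] at h ⊢ <;> omega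

section Products

variable (ts : List GraftTree)

/-- Since no largest set has the root isolated, no new partner can be acquired: a matched root
forces every branch root out. -/
theorem RootCount.attach_of_forall_free (h : ∀ t ∈ ts, t.count.kind = .free) (a c : ℕ) :
    RootCount.attach ⟨.free, a, 0, c⟩ ts =
      ⟨.free, a * (ts.map fun t => t.count.total).prod, 0,
        c * (ts.map fun t => t.count.out).prod⟩ := by
  induction ts generalizing a c with
  | nil => simp
  | cons t ts ih =>
    have ht := h t List.mem_cons_self
    have : (RootCount.mk .free a 0 c).join t.count =
        ⟨.free, a * t.count.total, 0, c * t.count.out⟩ := by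
      generalize t.count = E at ht
      rcases E with ⟨_ | _ | _, a', b', c'⟩ <;> simp [RootCount.join] at ht ⊢
    rw [RootCount.attach_cons, this, ih fun s hs => h s (List.mem_cons_of_mem _ hs)]
    simp [mul_assoc]

theorem RootCount.attach_of_pair_eq_zero (a : ℕ) :
    RootCount.attach ⟨.free, a, 0, 0⟩ ts =
      ⟨.free, a * (ts.map fun t => t.count.total).prod, 0, 0⟩ := by
  induction ts generalizing a with
  | nil => simp
  | cons t ts ih =>
    have : (RootCount.mk .free a 0 0).join t.count = ⟨.free, a * t.count.total, 0, 0⟩ := by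
      generalize t.count = E
      rcases E with ⟨_ | _ | _, a', b', c'⟩ <;> simp [RootCount.join]
    rw [RootCount.attach_cons, this, ih]
    simp [mul_assoc]

/-- Forcing the root of a non-free branch out costs a vertex, after which only sets avoiding the
common root compete. -/
theorem RootCount.attach_of_exists_not_free (h : ∃ t ∈ ts, t.count.kind ≠ .free) (a c : ℕ) :
    RootCount.attach ⟨.free, a, 0, c⟩ ts =
      ⟨.free, a * (ts.map fun t => t.count.total).prod, 0, 0⟩ := by
  induction ts generalizing a c with
  | nil => simp at h
  | cons t ts ih =>
    rw [RootCount.attach_cons]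
    by_cases ht : t.count.kind = .free
    · have : (RootCount.mk .free a 0 c).join t.count =
          ⟨.free, a * t.count.total, 0, c * t.count.out⟩ := by
        generalize t.count = E at ht
        rcases E with ⟨_ | _ | _, a', b', c'⟩ <;> simp [RootCount.join] at ht ⊢
      rw [this, ih]
      · simp [mul_assoc]
      · obtain ⟨s, hs, h⟩ := h
        obtain rfl | hs := List.mem_cons.1 hs
        · exact absurd ht h
        · exact ⟨s, hs, h⟩
    · have : (RootCount.mk .free a 0 c).join t.count = ⟨.free, a * t.count.total, 0, 0⟩ := by
        generalize t.count = E at ht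
        rcases E with ⟨_ | _ | _, a', b', c'⟩ <;> simp [RootCount.join] at ht ⊢
      rw [this, RootCount.attach_of_pair_eq_zero]
      simp [mul_assoc]

theorem prod_total_pos : 0 < (ts.map fun t => t.count.total).prod := by
  induction ts with
  | nil => simp
  | cons t ts ih => exact Nat.mul_pos t.total_pos ih

theorem exists_prod_total_le : ∃ f, 3 * f ≤ (ts.map size).sum ∧
    ((∃ t ∈ ts, t.count.kind ≠ .free) → 3 * f + 1 ≤ (ts.map size).sum) ∧
    (ts.map fun t => t.count.total).prod ≤ 3 ^ f ∧
    ((∀ t ∈ ts, t.size ≤ 3) ∨ 3 * (ts.map fun t => t.count.total).prod ≤ 2 * 3 ^ f) := by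
  induction ts with
  | nil => exact ⟨0, by simp⟩
  | cons t ts ih =>
    obtain ⟨f, h1, h2, h3, h4⟩ := ih
    obtain ⟨e, k1, k2, k3⟩ := t.bounded.exists_total_le
    refine ⟨e + f, ?_, ?_, ?_, ?_⟩
    · simp; omega
    · rintro ⟨s, hs, h⟩
      simp only [List.map_cons, List.sum_cons]
      obtain rfl | hs := List.mem_cons.1 hs
      · have : 1 ≤ s.count.kind.totalLoss := by
          revert h
          cases s.count.kind <;> simp [RootKind.totalLoss]
        omega
      · have := h2 ⟨s, hs, h⟩
        omega
    · simpa [pow_add] using Nat.mul_le_mul k2 h3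
    · simp only [List.map_cons, List.prod_cons, pow_add, List.forall_mem_cons]
      rcases le_or_gt t.size 3 with ht | ht
      · obtain h4 | h4 := h4
        · exact Or.inl ⟨ht, h4⟩
        · right
          have := Nat.mul_le_mul k2 h4
          linarith
      · right
        have := Nat.mul_le_mul (k3 ht) h3
        linarith

theorem exists_prod_out_le (h : ∀ t ∈ ts, t.count.kind = .free) :
    ∃ f, 3 * f + 3 * ts.length ≤ (ts.map size).sum ∧
      (ts.map fun t => t.count.out).prod ≤ 3 ^ f := by
  induction ts with
  | nil => exact ⟨0, by simp⟩
  | cons t ts ih =>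
    obtain ⟨f, h1, h2⟩ := ih fun s hs => h s (List.mem_cons_of_mem _ hs)
    obtain ⟨e, k1, k2⟩ := t.bounded.exists_out_le
    rw [h t List.mem_cons_self] at k1
    simp only [RootKind.outLoss] at k1
    refine ⟨e + f, by simp; omega, ?_⟩
    simpa [pow_add] using Nat.mul_le_mul k2 h2

end Products

theorem prod_total_of_allOrder3 {M : List GraftTree} (hM : AllOrder3 M) :
    (M.map fun t => t.count.total).prod = 3 ^ M.length := by
  induction M with
  | nil => rfl
  | cons t M ih =>
    rw [List.map_cons, List.prod_cons, ih fun s hs => hM s (List.mem_cons_of_mem _ hs),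
      List.length_cons, pow_succ, mul_comm]
    rcases hM t List.mem_cons_self with rfl | rfl <;> rfl

open List in
theorem sum_size_of_perm {ts : List GraftTree} {i j : ℕ} {M : List GraftTree} (hM : AllOrder3 M)
    (h : ts.Perm (replicate i leaf ++ (replicate j path2 ++ M))) :
    (ts.map size).sum = i + 2 * j + 3 * M.length := by
  rw [(h.map size).sum_eq]
  simp [sum_size_of_allOrder3 hM, size]
  ring

open List in
theorem prod_total_of_perm {ts : List GraftTree} {i j : ℕ} {M : List GraftTree} (hM : AllOrder3 M)
    (h : ts.Perm (replicate i leaf ++ (replicate j path2 ++ M))) :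
    (ts.map fun t => t.count.total).prod = 3 ^ M.length := by
  rw [(h.map _).prod_eq]
  have h1 : leaf.count.total = 1 := rfl
  have h2 : path2.count.total = 1 := rfl
  simp [prod_total_of_allOrder3 hM, h1, h2]

/-- The number of maximum dissociation sets of a cycle whose order is a multiple of `3`, with the
given rooted trees attached to one of its vertices. -/
def potCount (ts : List GraftTree) : ℕ := (RootCount.attach ⟨.free, 1, 0, 2⟩ ts).total

theorem potCount_of_forall_free {ts : List GraftTree} (h : ∀ t ∈ ts, t.count.kind = .free) :
    potCount ts = (ts.map fun t => t.count.total).prod +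
      2 * (ts.map fun t => t.count.out).prod := by
  rw [potCount, RootCount.attach_of_forall_free ts h]
  simp [RootCount.total]

theorem potCount_of_exists_not_free {ts : List GraftTree} (h : ∃ t ∈ ts, t.count.kind ≠ .free) :
    potCount ts = (ts.map fun t => t.count.total).prod := by
  rw [potCount, RootCount.attach_of_exists_not_free ts h]
  simp [RootCount.total]

/-- The lists attaining the maximum when the order is a multiple of `3`. -/
def Extremal0 (ts : List GraftTree) : Prop :=
  ∃ t m, ts = [t] ∧ t.children.Perm (path2 :: List.replicate m path3)

/-- The lists attaining the maximum when the order is `1` modulo `3`. -/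
def Extremal1 (ts : List GraftTree) : Prop :=
  ∃ t M, ts = [t] ∧ AllOrder3 M ∧ t.children.Perm (leaf :: path2 :: M)

/-- The lists attaining the maximum when the order is `2` modulo `3`. -/
def Extremal2 (ts : List GraftTree) : Prop :=
  ∃ M, AllOrder3 M ∧ ((∃ t, ts = [t] ∧ (t.children.Perm (path2 :: path2 :: M) ∨
      t.children.Perm (leaf :: leaf :: path2 :: M) ∨
      t.children.Perm (leaf :: leaf :: leaf :: leaf :: M))) ∨
    ts.Perm (path2 :: M) ∨ ts.Perm (leaf :: leaf :: M))

/-- The upper bound for `potCount`, and the equality case, for trees of total order `N`. -/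
def PotBound (ts : List GraftTree) (N : ℕ) : Prop :=
  (N % 3 = 0 → potCount ts ≤ 3 ^ (N / 3) + N / 3 + 1 ∧
    (potCount ts = 3 ^ (N / 3) + N / 3 + 1 → Extremal0 ts)) ∧
  (N % 3 = 1 → potCount ts ≤ 3 ^ (N / 3) + 1 ∧
    (potCount ts = 3 ^ (N / 3) + 1 → Extremal1 ts)) ∧
  (N % 3 = 2 → potCount ts ≤ 3 ^ (N / 3) ∧
    (potCount ts = 3 ^ (N / 3) → Extremal2 ts))

theorem PotBound.of_lt {ts : List GraftTree} {N : ℕ} (h : potCount ts < 3 ^ (N / 3)) :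
    PotBound ts N :=
  ⟨fun _ => ⟨by omega, by omega⟩, fun _ => ⟨by omega, by omega⟩, fun _ => ⟨by omega, by omega⟩⟩

theorem pow_le_pow_div {f N : ℕ} (h : 3 * f ≤ N) : 3 ^ f ≤ 3 ^ (N / 3) :=
  Nat.pow_le_pow_right (by norm_num) (by omega)

/-- The value is a product of totals, at most 3^⌊N/3⌋, so equality is possible only in the third
case and only with all branches of order at most three. -/
theorem potBound_of_exists_not_free {ts : List GraftTree} (h : ∃ t ∈ ts, t.count.kind ≠ .free) :
    PotBound ts (ts.map size).sum := by
  obtain ⟨f, h1, h2, h3, h4⟩ := exists_prod_total_le ts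
  rw [← potCount_of_exists_not_free h] at h3 h4
  have hle := pow_le_pow_div h1
  refine ⟨fun _ => ⟨by omega, by omega⟩, fun _ => ⟨by omega, by omega⟩, fun hr => ⟨by omega, ?_⟩⟩
  intro heq
  have hpos : 0 < 3 ^ f := by positivity
  obtain h4 | h4 := h4
  · obtain ⟨i, j, M, hM, hp⟩ := exists_perm_of_size_le_three ts h4
    rw [potCount_of_exists_not_free h, prod_total_of_perm hM hp] at heq
    have hm := Nat.pow_right_injective (by norm_num : 2 ≤ 3) heq
    have hs := sum_size_of_perm hM hp
    refine ⟨M, hM, Or.inr ?_⟩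
    -- The order i + 2j + 3|M| has quotient |M| and remainder 2, hence i + 2j = 2.
    have : (i = 0 ∧ j = 1) ∨ (i = 2 ∧ j = 0) := by omega
    obtain ⟨rfl, rfl⟩ | ⟨rfl, rfl⟩ := this
    · exact Or.inl (by simpa using hp)
    · exact Or.inr (by simpa [List.replicate_succ] using hp)
  · omega

/-- Write Q = 3^⌊N/3⌋. The product of the `out` counts is at most Q/9. A branch of order above three
leaves at most (2/3 + 2/9)Q < Q. Otherwise all branches have order three and the value is 3^m + 2
with m ≥ 2, which is less than 3^m + m + 1. -/
theorem potBound_of_two_le_length {ts : List GraftTree} (h : ∀ t ∈ ts, t.count.kind = .free)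
    (hl : 2 ≤ ts.length) : PotBound ts (ts.map size).sum := by
  obtain ⟨f, h1, -, h3, h4⟩ := exists_prod_total_le ts
  obtain ⟨g, k1, k2⟩ := exists_prod_out_le ts h
  have hle := pow_le_pow_div h1
  have hle' : 9 * 3 ^ g ≤ 3 ^ ((ts.map size).sum / 3) := by
    have := pow_le_pow_div (f := g + 2) (N := (ts.map size).sum) (by omega)
    rw [pow_add] at this
    omega
  have hpos : 0 < 3 ^ f := by positivity
  have hv := potCount_of_forall_free h
  obtain h4 | h4 := h4
  · obtain ⟨i, j, M, hM, hp⟩ := exists_perm_of_size_le_three ts h4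
    have hi : i = 0 := by
      by_contra hi
      have := h leaf (hp.mem_iff.2 (by simp [hi]))
      simp [count] at this
    have hj : j = 0 := by
      by_contra hj
      have := h path2 (hp.mem_iff.2 (by simp [hj]))
      simp [count, RootCount.join] at this
    subst hi hj
    have hs := sum_size_of_perm hM hp
    have hl' := hp.length_eq
    simp only [List.replicate_zero, List.nil_append] at hl'
    have hg : g = 0 := by omega
    subst hg
    rw [prod_total_of_perm hM hp] at hv
    have hq : (ts.map size).sum / 3 = M.length := by omega
    rw [PotBound, hq]
    refine ⟨fun _ => ⟨by omega, by omega⟩, fun _ => by omega, fun _ => by omega⟩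
  · apply PotBound.of_lt
    omega

theorem potBound_of_single {t : GraftTree} (h : t.count.kind = .free) (ht : 4 ≤ t.size) :
    PotBound [t] t.size := by
  have hv : potCount [t] = t.count.total + 2 * t.count.out := by
    rw [potCount_of_forall_free (by simpa using h)]
    simp
  obtain hs | ⟨e, he, h1⟩ := t.exists_out_le_of_large_child
  · obtain ⟨i, j, M, hM, hp⟩ := exists_perm_of_size_le_three _ hs
    have hsz := size_eq_children t
    rw [sum_size_of_perm hM hp] at hsz
    have hc := count_of_perm hM hp h
    obtain ⟨rfl, rfl, p, hpM, hp', hc⟩ | ⟨rfl, rfl, hc⟩ | ⟨rfl, rfl, hc⟩ | ⟨hij, hij', hc⟩ := hc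
    · rw [hc] at hv
      simp only [RootCount.total] at hv
      have hq : t.size / 3 = M.length + 1 := by omega
      rw [PotBound, hq, pow_succ]
      refine ⟨fun _ => ⟨by omega, fun heq => ?_⟩, fun _ => by omega, fun _ => by omega⟩
      refine ⟨t, M.length, rfl, ?_⟩
      rw [hp'.1 (by omega)] at hp
      simpa using hp
    · rw [hc] at hv
      simp only [RootCount.total] at hv
      have hq : t.size / 3 = M.length + 1 := by omega
      rw [PotBound, hq, pow_succ]
      -- The assumption `4 ≤ t.size` makes `M` nonempty. For empty `M` the tree of order three
      -- rooted at its centre would give 3 + 2 and meet the bound as well.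
      exact ⟨fun _ => ⟨by omega, fun heq => by omega⟩, fun _ => by omega, fun _ => by omega⟩
    · rw [hc] at hv
      simp only [RootCount.total] at hv
      have hq : t.size / 3 = M.length + 1 := by omega
      rw [PotBound, hq, pow_succ]
      refine ⟨fun _ => by omega, fun _ => ⟨by omega, fun heq => ?_⟩, fun _ => by omega⟩
      exact ⟨t, M, rfl, hM, by simpa using hp⟩
    · rw [hc] at hv
      simp only [RootCount.total] at hv
      have hq := pow_le_pow_div (f := M.length + 1) (N := t.size) (by omega)
      have hv' : potCount [t] = 3 ^ (M.length + 1) := by rw [hv, pow_succ]; ring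
      refine ⟨fun _ => ⟨by omega, by omega⟩, fun _ => ⟨by omega, by omega⟩,
        fun hr => ⟨by omega, fun heq => ?_⟩⟩
      rw [hv'] at heq
      have hm := Nat.pow_right_injective (by norm_num : 2 ≤ 3) heq
      refine ⟨M, hM, Or.inl ⟨t, rfl, ?_⟩⟩
      -- The order 1 + i + 2j + 3|M| has quotient |M| + 1 and remainder 2, so i + 2j = 4; the pairs
      -- (1, j) are impossible by parity.
      have : (i = 0 ∧ j = 2) ∨ (i = 2 ∧ j = 1) ∨ (i = 4 ∧ j = 0) := by omega
      obtain ⟨rfl, rfl⟩ | ⟨rfl, rfl⟩ | ⟨rfl, rfl⟩ := this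
      · exact Or.inl (by simpa [List.replicate_succ] using hp)
      · exact Or.inr (Or.inl (by simpa [List.replicate_succ] using hp))
      · exact Or.inr (Or.inr (by simpa [List.replicate_succ] using hp))
  · rw [h] at he
    simp only [RootKind.outLoss] at he
    have ha := t.count_pos.1
    -- A positive `out` with 3·out ≤ 2·3^e rules out e = 0.
    have he1 : 1 ≤ e := by
      rcases e with _ | e
      · omega
      · omega
    have hb := t.bounded
    have hle := pow_le_pow_div (f := e + 1) (N := t.size) (by omega)
    rw [pow_succ] at hle
    generalize t.count = D at *
    rcases D with ⟨k, a, b, c⟩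
    simp only at h
    subst h
    simp only [RootCount.Bounded] at hb
    obtain hb | ⟨-, f, U, rfl, hf, -, -, -, hx, hx'⟩ := hb
    · omega
    · simp only [RootCount.total] at hv h1
      have hfq := pow_le_pow_div (f := f + 1) (N := t.size) (by omega)
      rw [pow_succ] at hfq
      -- Order 6 lies below the range of the factor 13/9. There total ≤ 6 and out ≤ 2, so the value
      -- is at most 10, against the bound 12.
      rcases Nat.lt_or_ge t.size 7 with h7 | h7
      · have h6 : t.size = 6 := by omega
        have : e = 1 := by omega
        subst this
        have hf1 : f ≤ 1 := by omega
        have hv' : potCount [t] ≤ 10 := by interval_cases f <;> omega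
        rw [h6]
        exact ⟨fun _ => ⟨by omega, by omega⟩, fun _ => by omega, fun _ => by omega⟩
      · have := hx' h7
        have hpos : 0 < 3 ^ e := by positivity
        -- With Q = 3^⌊N/3⌋, total ≤ (13/27)Q and 2·out ≤ (4/9)Q, so the value is at most (25/27)Q.
        exact PotBound.of_lt (by omega)

theorem potBound {ts : List GraftTree} (h : 4 ≤ (ts.map size).sum) :
    PotBound ts (ts.map size).sum := by
  by_cases hf : ∃ t ∈ ts, t.count.kind ≠ .free
  · exact potBound_of_exists_not_free hf
  · push Not at hf
    rcases ts with _ | ⟨t, _ | ⟨s, ts⟩⟩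
    · simp at h
    · simpa using potBound_of_single (by simpa using hf) (by simpa using h)
    · exact potBound_of_two_le_length hf (by simp)

/-! ### Isomorphisms of pointed graphs -/

/-- Two graphs with distinguished vertices are isomorphic. -/
def PointedIso {V W : Type*} (G : SimpleGraph V) (r : V) (H : SimpleGraph W) (s : W) : Prop :=
  ∃ e : G ≃g H, e r = s

namespace PointedIso

variable {V W U V' W' : Type*} {G : SimpleGraph V} {H : SimpleGraph W} {K : SimpleGraph U}
  {G' : SimpleGraph V'} {H' : SimpleGraph W'} {r : V} {s : W} {t : U} {r' : V'} {s' : W'}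

theorem refl (G : SimpleGraph V) (r : V) : PointedIso G r G r := ⟨Iso.refl, rfl⟩

theorem symm (h : PointedIso G r H s) : PointedIso H s G r := by
  obtain ⟨e, rfl⟩ := h
  exact ⟨e.symm, by simp⟩

theorem trans (h : PointedIso G r H s) (h' : PointedIso H s K t) : PointedIso G r K t := by
  obtain ⟨e, rfl⟩ := h
  obtain ⟨e', rfl⟩ := h'
  exact ⟨e.trans e', rfl⟩

theorem joinByEdge (h : PointedIso G r G' r') (h' : PointedIso H s H' s') :
    PointedIso (joinByEdge G H r s) (Sum.inl r) (joinByEdge G' H' r' s') (Sum.inl r') := by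
  obtain ⟨e, rfl⟩ := h
  obtain ⟨e', rfl⟩ := h'
  refine ⟨⟨Equiv.sumCongr e.toEquiv e'.toEquiv, ?_⟩, rfl⟩
  rintro (a | a) (b | b) <;> simp [e.map_adj_iff, e'.map_adj_iff]

theorem joinByEdge_right_comm (G : SimpleGraph V) (H : SimpleGraph W) (K : SimpleGraph U)
    (r : V) (s : W) (t : U) :
    PointedIso (_root_.joinByEdge (_root_.joinByEdge G H r s) K (Sum.inl r) t)
      (Sum.inl (Sum.inl r)) (_root_.joinByEdge (_root_.joinByEdge G K r t) H (Sum.inl r) s)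
      (Sum.inl (Sum.inl r)) := by
  refine ⟨⟨(Equiv.sumAssoc _ _ _).trans (((Equiv.refl _).sumCongr (Equiv.sumComm _ _)).trans
    (Equiv.sumAssoc _ _ _).symm), ?_⟩, rfl⟩
  rintro ((a | a) | a) ((b | b) | b) <;> simp

end PointedIso

namespace PointedGraph

/-- Two pointed graphs are isomorphic. -/
def Iso (P Q : PointedGraph) : Prop := PointedIso P.graph P.root Q.graph Q.root

variable {P Q R P' Q' : PointedGraph}

theorem Iso.refl (P : PointedGraph) : P.Iso P := PointedIso.refl _ _

theorem Iso.symm (h : P.Iso Q) : Q.Iso P := PointedIso.symm h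

theorem Iso.trans (h : P.Iso Q) (h' : Q.Iso R) : P.Iso R := PointedIso.trans h h'

theorem Iso.graft (h : P.Iso P') (h' : Q.Iso Q') : (P.graft Q).Iso (P'.graft Q') :=
  PointedIso.joinByEdge h h'

theorem graft_right_comm (P Q R : PointedGraph) :
    ((P.graft Q).graft R).Iso ((P.graft R).graft Q) :=
  PointedIso.joinByEdge_right_comm _ _ _ _ _ _

theorem Iso.attach (h : P.Iso Q) (L : List GraftTree) : (P.attach L).Iso (Q.attach L) := by
  induction L generalizing P Q with
  | nil => exact h
  | cons t L ih => exact ih (h.graft (Iso.refl _))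

theorem attach_perm (P : PointedGraph) {L M : List GraftTree} (h : L.Perm M) :
    (P.attach L).Iso (P.attach M) := by
  induction h generalizing P with
  | nil => exact Iso.refl _
  | cons t _ ih => exact ih _
  | swap s t L => exact Iso.attach (graft_right_comm _ _ _) L
  | trans _ _ ih ih' => exact (ih P).trans (ih' P)

/-- The pointed graph with one vertex. -/
abbrev point : PointedGraph := GraftTree.leaf.toPointed

end PointedGraph

/-! ### Identification of distinguished vertices -/

section Wedge

variable {V W U V' U' : Type*} {G : SimpleGraph V} {H : SimpleGraph W} {K : SimpleGraph U}
  {G' : SimpleGraph V'} {K' : SimpleGraph U'} {r : V} {s : W} {t : U} {r' : V'} {t' : U'}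

/-- The graph `K` arises from disjoint copies `f` of `G` and `g` of `H` by identifying
the vertices `r` and `s` to the vertex `t`. -/
structure IsWedge (G : SimpleGraph V) (r : V) (H : SimpleGraph W) (s : W) (K : SimpleGraph U)
    (t : U) (f : V → U) (g : W → U) : Prop where
  left_injective : Function.Injective f
  right_injective : Function.Injective g
  left_root : f r = t
  right_root : g s = t
  eq_root : ∀ x y, f x = g y → x = r ∧ y = s
  exists_eq : ∀ z, (∃ x, f x = z) ∨ ∃ y, g y = z
  adj_iff : ∀ z z', K.Adj z z' ↔ (∃ x x', G.Adj x x' ∧ f x = z ∧ f x' = z') ∨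
    ∃ y y', H.Adj y y' ∧ g y = z ∧ g y' = z'

namespace IsWedge

variable {f : V → U} {g : W → U} {f' : V → U'} {g' : W → U'}

theorem symm (h : IsWedge G r H s K t f g) : IsWedge H s G r K t g f where
  left_injective := h.right_injective
  right_injective := h.left_injective
  left_root := h.right_root
  right_root := h.left_root
  eq_root x y hxy := (h.eq_root y x hxy.symm).symm
  exists_eq z := (h.exists_eq z).symm
  adj_iff z z' := (h.adj_iff z z').trans or_comm

theorem exists_hom (h : IsWedge G r H s K t f g) (h' : IsWedge G r H s K' t' f' g') :
    ∃ φ : U → U', (∀ x, φ (f x) = f' x) ∧ (∀ y, φ (g y) = g' y) ∧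
      ∀ z z', K.Adj z z' → K'.Adj (φ z) (φ z') := by
  have key : ∀ z, ∃ w, (∀ x, f x = z → f' x = w) ∧ ∀ y, g y = z → g' y = w := by
    intro z
    obtain ⟨x, rfl⟩ | ⟨y, rfl⟩ := h.exists_eq z
    · refine ⟨f' x, fun x' hx' => by rw [h.left_injective hx'], fun y hy => ?_⟩
      obtain ⟨rfl, rfl⟩ := h.eq_root x y hy.symm
      rw [h'.left_root, h'.right_root]
    · refine ⟨g' y, fun x hx => ?_, fun y' hy' => by rw [h.right_injective hy']⟩
      obtain ⟨rfl, rfl⟩ := h.eq_root x y hx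
      rw [h'.left_root, h'.right_root]
  choose φ hφ using key
  have hf : ∀ x, φ (f x) = f' x := fun x => ((hφ (f x)).1 x rfl).symm
  have hg : ∀ y, φ (g y) = g' y := fun y => ((hφ (g y)).2 y rfl).symm
  refine ⟨φ, hf, hg, fun z z' hz => ?_⟩
  rw [h'.adj_iff]
  obtain ⟨x, x', hx, rfl, rfl⟩ | ⟨y, y', hy, rfl, rfl⟩ := (h.adj_iff z z').1 hz
  · exact Or.inl ⟨x, x', hx, (hf x).symm, (hf x').symm⟩
  · exact Or.inr ⟨y, y', hy, (hg y).symm, (hg y').symm⟩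

/-- The two copies cover `K` and overlap only in the root, so maps defined on each copy patch
together, and the two patched maps are mutually inverse. This avoids writing explicit bijections
between glued graphs and iterated joins. -/
theorem unique (h : IsWedge G r H s K t f g) (h' : IsWedge G r H s K' t' f' g') :
    PointedIso K t K' t' := by
  obtain ⟨φ, hf, hg, hadj⟩ := h.exists_hom h'
  obtain ⟨ψ, hf', hg', hadj'⟩ := h'.exists_hom h
  have h1 : ∀ z, ψ (φ z) = z := by
    intro z
    obtain ⟨x, rfl⟩ | ⟨y, rfl⟩ := h.exists_eq z
    · rw [hf, hf']
    · rw [hg, hg']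
  have h2 : ∀ z, φ (ψ z) = z := by
    intro z
    obtain ⟨x, rfl⟩ | ⟨y, rfl⟩ := h'.exists_eq z
    · rw [hf', hf]
    · rw [hg', hg]
  refine ⟨⟨⟨φ, ψ, h1, h2⟩, ?_⟩, ?_⟩
  · intro a b
    refine ⟨fun hab => ?_, hadj a b⟩
    have := hadj' _ _ hab
    simpa [h1] using this
  · show φ t = t'
    rw [← h.left_root, hf, h'.left_root]

theorem congr_left (h : IsWedge G r H s K t f g) (e : PointedIso G' r' G r) :
    ∃ f', IsWedge G' r' H s K t f' g := by
  obtain ⟨e, he⟩ := e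
  refine ⟨fun x => f (e x), ?_, h.right_injective, ?_, h.right_root, ?_, ?_, ?_⟩
  · exact h.left_injective.comp e.injective
  · rw [he, h.left_root]
  · intro x y hxy
    obtain ⟨h1, h2⟩ := h.eq_root _ _ hxy
    exact ⟨e.injective (h1.trans he.symm), h2⟩
  · intro z
    obtain ⟨x, rfl⟩ | h := h.exists_eq z
    · exact Or.inl ⟨e.symm x, by simp⟩
    · exact Or.inr h
  · intro z z'
    rw [h.adj_iff]
    refine or_congr_left ⟨?_, ?_⟩
    · rintro ⟨x, x', hx, rfl, rfl⟩
      exact ⟨e.symm x, e.symm x', e.symm.map_adj_iff.2 hx, by simp, by simp⟩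
    · rintro ⟨x, x', hx, rfl, rfl⟩
      exact ⟨e x, e x', e.map_adj_iff.2 hx, rfl, rfl⟩

end IsWedge

/-- An edge from `r` to `s` is the same as gluing to `r` the graph `H` with a pendant vertex added
at `s`. -/
theorem isWedge_joinByEdge (G : SimpleGraph V) (H : SimpleGraph W) (r : V) (s : W) :
    IsWedge (joinByEdge (⊥ : SimpleGraph Unit) H () s) (Sum.inl ()) G r (joinByEdge G H r s)
      (Sum.inl r) (Sum.map (fun _ => r) id) Sum.inl where
  left_injective := by
    rintro (x | x) (y | y) <;> simp
  right_injective := Sum.inl_injective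
  left_root := rfl
  right_root := rfl
  eq_root := by
    rintro (x | x) y h
    · simpa [eq_comm] using h
    · simp at h
  exists_eq := by
    rintro (x | x)
    · exact Or.inr ⟨x, rfl⟩
    · exact Or.inl ⟨Sum.inr x, rfl⟩
  adj_iff := by
    rintro (x | x) (y | y) <;> simp [eq_comm, and_comm]

theorem isWedge_unit (G : SimpleGraph V) (r : V) :
    IsWedge G r (⊥ : SimpleGraph Unit) () G r id fun _ => r where
  left_injective := Function.injective_id
  right_injective := fun _ _ _ => rfl
  left_root := rfl
  right_root := rfl
  eq_root := fun _ _ h => ⟨h, rfl⟩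
  exists_eq := fun z => Or.inl ⟨z, rfl⟩
  adj_iff := by simp

theorem IsWedge.joinByEdge {f : V → U} {g : W → U} (h : IsWedge G r H s K t f g)
    (A : SimpleGraph V') (a : V') :
    IsWedge G r (joinByEdge H A s a) (Sum.inl s) (joinByEdge K A t a) (Sum.inl t)
      (fun x => Sum.inl (f x)) (Sum.map g id) where
  left_injective := fun x y hxy => h.left_injective (Sum.inl_injective hxy)
  right_injective := h.right_injective.sumMap Function.injective_id
  left_root := by rw [h.left_root]
  right_root := by simp [h.right_root]
  eq_root := by
    rintro x (y | y) hxy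
    · have := h.eq_root x y (by simpa using hxy)
      simpa using this
    · simp at hxy
  exists_eq := by
    rintro (z | z)
    · obtain ⟨x, rfl⟩ | ⟨y, rfl⟩ := h.exists_eq z
      · exact Or.inl ⟨x, rfl⟩
      · exact Or.inr ⟨Sum.inl y, rfl⟩
    · exact Or.inr ⟨Sum.inr z, rfl⟩
  adj_iff := by
    have hg : ∀ y, g y = t ↔ y = s := fun y => by rw [← h.right_root, h.right_injective.eq_iff]
    rintro (z | z) (z' | z')
    · simp [h.adj_iff]
    · simp only [joinByEdge_inl_inr, Sum.exists, Sum.map_inl, Sum.map_inr, id]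
      simp [← h.right_root, eq_comm, and_comm]
    · simp only [joinByEdge_inr_inl, Sum.exists, Sum.map_inl, Sum.map_inr, id]
      simp [← h.right_root, eq_comm, and_comm]
    · simp

theorem glueIncl_root (L : List PointedGraph) (i : Fin L.length) :
    glueIncl L i (L.get i).root = none := dif_pos rfl

theorem glueIncl_of_ne (L : List PointedGraph) (i : Fin L.length) {x : (L.get i).Vert}
    (h : x ≠ (L.get i).root) : glueIncl L i x = some ⟨i, x, h⟩ := dif_neg h

theorem glueIncl_injective (L : List PointedGraph) (i : Fin L.length) :
    Function.Injective (glueIncl L i) := by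
  intro x y h
  by_cases hx : x = (L.get i).root <;> by_cases hy : y = (L.get i).root
  · rw [hx, hy]
  · rw [hx, glueIncl_root, glueIncl_of_ne L i hy] at h
    cases h
  · rw [hy, glueIncl_root, glueIncl_of_ne L i hx] at h
    cases h
  · rw [glueIncl_of_ne L i hx, glueIncl_of_ne L i hy] at h
    simpa using h

theorem glue_adj (L : List PointedGraph) (z z' : GlueVert L) :
    (glue L).graph.Adj z z' ↔ ∃ i x x', (L.get i).graph.Adj x x' ∧ glueIncl L i x = z ∧
      glueIncl L i x' = z' := by
  refine iSup_adj.trans ?_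
  refine exists_congr fun i => ?_
  rw [map_adj']
  constructor
  · exact fun h => h.2
  · rintro ⟨x, x', h, rfl, rfl⟩
    exact ⟨fun hx => h.ne (glueIncl_injective L i hx), x, x', h, rfl, rfl⟩

/-- The map from a glued graph to the graph obtained by gluing one graph more. -/
def glueTail (T : PointedGraph) (L : List PointedGraph) : GlueVert L → GlueVert (T :: L) :=
  Option.map fun p => ⟨Fin.succ p.1, p.2⟩

theorem glueTail_glueIncl (T : PointedGraph) (L : List PointedGraph) (i : Fin L.length)
    (x : (L.get i).Vert) : glueTail T L (glueIncl L i x) = glueIncl (T :: L) i.succ x := by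
  by_cases hx : x = (L.get i).root
  · rw [hx, glueIncl_root]
    exact (glueIncl_root (T :: L) i.succ).symm
  · rw [glueIncl_of_ne L i hx]
    exact (glueIncl_of_ne (T :: L) i.succ hx).symm

theorem isWedge_glue_cons (T : PointedGraph) (L : List PointedGraph) :
    IsWedge T.graph T.root (glue L).graph (glue L).root (glue (T :: L)).graph
      (glue (T :: L)).root (glueIncl (T :: L) 0) (glueTail T L) where
  left_injective := glueIncl_injective (T :: L) 0
  right_injective := by
    apply Option.map_injective
    rintro ⟨i, x⟩ ⟨j, y⟩ h
    simpa [Sigma.mk.injEq] using h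
  left_root := glueIncl_root (T :: L) 0
  right_root := rfl
  eq_root := by
    intro x y h
    by_cases hx : x = T.root
    · refine ⟨hx, ?_⟩
      rw [hx] at h
      have h' : none = glueTail T L y := (glueIncl_root (T :: L) 0).symm.trans h
      rcases y with _ | y
      · rfl
      · cases h'
    · have h' : some ⟨0, x, hx⟩ = glueTail T L y := (glueIncl_of_ne (T :: L) 0 hx).symm.trans h
      rcases y with _ | ⟨i, y⟩
      · cases h'
      · have := congrArg (fun p => p.map Sigma.fst) h'
        simp [glueTail] at this
        exact absurd this.symm (Fin.succ_ne_zero i)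
  exists_eq := by
    rintro (_ | ⟨i, x, hx⟩)
    · exact Or.inr ⟨none, rfl⟩
    · induction i using Fin.cases with
      | zero => exact Or.inl ⟨x, glueIncl_of_ne (T :: L) 0 hx⟩
      | succ i => exact Or.inr ⟨some ⟨i, x, hx⟩, rfl⟩
  adj_iff := by
    intro z z'
    refine (glue_adj _ _ _).trans ?_
    constructor
    · rintro ⟨i, x, x', h, rfl, rfl⟩
      induction i using Fin.cases with
      | zero => exact Or.inl ⟨x, x', h, rfl, rfl⟩
      | succ i =>
        exact Or.inr ⟨glueIncl L i x, glueIncl L i x', (glue_adj _ _ _).2 ⟨i, x, x', h, rfl, rfl⟩,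
          glueTail_glueIncl _ _ _ _, glueTail_glueIncl _ _ _ _⟩
    · rintro (⟨x, x', h, rfl, rfl⟩ | ⟨y, y', h, rfl, rfl⟩)
      · exact ⟨0, x, x', h, rfl, rfl⟩
      · obtain ⟨i, x, x', hx, rfl, rfl⟩ := (glue_adj _ _ _).1 h
        exact ⟨i.succ, x, x', hx, (glueTail_glueIncl _ _ _ _).symm, (glueTail_glueIncl _ _ _ _).symm⟩

end Wedge

/-! ### Glued graphs as trees -/

namespace PointedGraph

/-- The pointed graph `T` consists of a new distinguished vertex, attached to the root of `t`. -/
def IsBranch (T : PointedGraph) (t : GraftTree) : Prop := T.Iso (point.graft t.toPointed)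

theorem glue_nil_iso : (glue []).Iso point := by
  refine ⟨⟨⟨fun _ => (), fun _ => none, ?_, fun _ => rfl⟩, ?_⟩, rfl⟩
  · rintro (_ | ⟨i, _⟩)
    · rfl
    · exact i.elim0
  · rintro (_ | ⟨i, _⟩) (_ | ⟨j, _⟩)
    · constructor <;> intro h
      · exact absurd h (SimpleGraph.irrefl _)
      · exact absurd h (SimpleGraph.irrefl _)
    · exact j.elim0
    · exact i.elim0
    · exact i.elim0

theorem glue_cons_iso {T : PointedGraph} {t : GraftTree} (h : T.IsBranch t)
    (L : List PointedGraph) : (glue (T :: L)).Iso ((glue L).graft t.toPointed) := by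
  obtain ⟨f, hf⟩ := (isWedge_joinByEdge (glue L).graph t.toPointed.graph (glue L).root
    t.toPointed.root).congr_left h
  exact (isWedge_glue_cons T L).unique hf

/-- `glue` adds the head of a list last, whereas `attach`, a left fold, adds it first; a permutation
reconciles the two. -/
theorem attach_reverse_cons (P : PointedGraph) (t : GraftTree) (L : List GraftTree) :
    (P.attach (t :: L)).Iso ((P.attach L).graft t.toPointed) := by
  have h := P.attach_perm (List.perm_append_singleton t L).symm
  have : P.attach (L ++ [t]) = (P.attach L).graft t.toPointed := by
    simp [PointedGraph.attach]
  rwa [this] at h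

theorem glue_iso {L : List PointedGraph} {ts : List GraftTree} (h : List.Forall₂ IsBranch L ts) :
    (glue L).Iso (point.attach ts) := by
  induction h with
  | nil => exact glue_nil_iso
  | cons hT _ ih =>
    exact (glue_cons_iso hT _).trans ((ih.graft (Iso.refl _)).trans
      (attach_reverse_cons _ _ _).symm)

theorem exists_isWedge_attach (P : PointedGraph) (ts : List GraftTree) :
    ∃ f g, IsWedge P.graph P.root (point.attach ts).graph (point.attach ts).root
      (P.attach ts).graph (P.attach ts).root f g := by
  induction ts using List.reverseRecOn with
  | nil => exact ⟨_, _, isWedge_unit P.graph P.root⟩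
  | append_singleton ts t ih =>
    obtain ⟨f, g, h⟩ := ih
    have key : ∀ Q : PointedGraph, Q.attach (ts ++ [t]) = (Q.attach ts).graft t.toPointed := by
      simp [PointedGraph.attach]
    rw [key, key]
    exact ⟨_, _, h.joinByEdge _ _⟩

theorem glue_singleton_iso (T : PointedGraph) : (glue [T]).Iso T := by
  obtain ⟨f, hf⟩ := (isWedge_unit T.graph T.root).symm.congr_left glue_nil_iso
  exact (isWedge_glue_cons T []).unique hf.symm

theorem glue_pair_iso (P T : PointedGraph) {ts : List GraftTree} (h : T.Iso (point.attach ts)) :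
    (glue [P, T]).Iso (P.attach ts) := by
  obtain ⟨f, g, hw⟩ := exists_isWedge_attach P ts
  obtain ⟨g', hw'⟩ := hw.symm.congr_left ((glue_singleton_iso T).trans h)
  exact (isWedge_glue_cons P [T]).unique hw'.symm

theorem pointedIso_pathGraph (n : ℕ) : PointedIso (pathGraph (n + 2)) 0
    (joinByEdge (⊥ : SimpleGraph Unit) (pathGraph (n + 1)) () 0) (Sum.inl ()) := by
  refine ⟨⟨⟨fun i => Fin.cases (Sum.inl ()) Sum.inr i, Sum.elim (fun _ => 0) Fin.succ, ?_, ?_⟩, ?_⟩,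
    rfl⟩
  · intro i
    induction i using Fin.cases <;> rfl
  · rintro (i | i) <;> rfl
  · intro i j
    induction i using Fin.cases with
    | zero =>
      induction j using Fin.cases with
      | zero => simp
      | succ j =>
        refine joinByEdge_inl_inr.trans ?_
        rw [pathGraph_adj, Fin.ext_iff, Fin.val_succ]
        simp only [Fin.val_zero, true_and]
        omega
    | succ i =>
      induction j using Fin.cases with
      | zero =>
        refine joinByEdge_inr_inl.trans ?_
        rw [pathGraph_adj, Fin.ext_iff, Fin.val_succ]
        simp only [Fin.val_zero, true_and]
        omega
      | succ j =>
        refine joinByEdge_inr_inr.trans ?_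
        rw [pathGraph_adj, pathGraph_adj]
        change ((i : ℕ) + 1 = j ∨ (j : ℕ) + 1 = i) ↔
          (i : ℕ) + 1 + 1 = (j : ℕ) + 1 ∨ (j : ℕ) + 1 + 1 = (i : ℕ) + 1
        omega

theorem leafPath_iso (n : ℕ) : (leafPath (n + 2)).Iso (point.graft (leafPath (n + 1))) :=
  pointedIso_pathGraph n

theorem leafPath_one_iso : (leafPath 1).Iso point := by
  have : PointedIso (pathGraph 1) 0 (⊥ : SimpleGraph Unit) () := by
    refine ⟨⟨Equiv.ofUnique _ _, ?_⟩, rfl⟩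
    intro i j
    simp [pathGraph_adj]
  exact this

theorem leafPath_two_isBranch : (leafPath 2).IsBranch leaf :=
  (leafPath_iso 0).trans ((Iso.refl _).graft leafPath_one_iso)

theorem leafPath_three_isBranch : (leafPath 3).IsBranch path2 :=
  (leafPath_iso 1).trans ((Iso.refl _).graft leafPath_two_isBranch)

theorem leafPath_four_isBranch : (leafPath 4).IsBranch path3 :=
  (leafPath_iso 2).trans ((Iso.refl _).graft leafPath_three_isBranch)

theorem leafClaw_isBranch : leafClaw.IsBranch cherry := by
  have : PointedIso (completeBipartiteGraph (Fin 1) (Fin 3)) (Sum.inr 0)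
      (joinByEdge (⊥ : SimpleGraph Unit) (joinByEdge (joinByEdge (⊥ : SimpleGraph Unit)
        (⊥ : SimpleGraph Unit) () ()) (⊥ : SimpleGraph Unit) (Sum.inl ()) ()) ()
        (Sum.inl (Sum.inl ()))) (Sum.inl ()) := by
    refine ⟨⟨⟨Sum.elim (fun _ => Sum.inr (Sum.inl (Sum.inl ())))
      ![Sum.inl (), Sum.inr (Sum.inl (Sum.inr ())), Sum.inr (Sum.inr ())],
      Sum.elim (fun _ => Sum.inr 0) (Sum.elim (Sum.elim (fun _ => Sum.inl 0) fun _ => Sum.inr 1)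
        fun _ => Sum.inr 2), ?_, ?_⟩, ?_⟩, rfl⟩
    · rintro (i | i)
      · simp [Subsingleton.elim i 0]
      · fin_cases i <;> rfl
    · rintro (i | ((i | i) | i)) <;> rfl
    · rintro (i | i) (j | j)
      · simp
      · fin_cases j <;> simp
      · fin_cases i <;> simp
      · fin_cases i <;> fin_cases j <;> simp
  exact this

theorem forall₂_isBranch_replicate (m : ℕ) :
    List.Forall₂ IsBranch (List.replicate m (leafPath 4)) (List.replicate m path3) := by
  induction m with
  | zero => exact List.Forall₂.nil
  | succ m ih => exact List.Forall₂.cons leafPath_four_isBranch ih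

theorem exists_forall₂_of_allP4OrClaw {L : List PointedGraph} (h : AllP4OrClaw L) :
    ∃ M, AllOrder3 M ∧ List.Forall₂ IsBranch L M := by
  induction L with
  | nil => exact ⟨[], by simp [AllOrder3], List.Forall₂.nil⟩
  | cons T L ih =>
    obtain ⟨M, hM, hL⟩ := ih fun S hS => h S (List.mem_cons_of_mem _ hS)
    obtain rfl | rfl := h T List.mem_cons_self
    · exact ⟨path3 :: M, List.forall_mem_cons.2 ⟨Or.inl rfl, hM⟩,
        List.Forall₂.cons leafPath_four_isBranch hL⟩
    · exact ⟨cherry :: M, List.forall_mem_cons.2 ⟨Or.inr rfl, hM⟩,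
        List.Forall₂.cons leafClaw_isBranch hL⟩

theorem exists_forall₂_of_allOrder3 {M : List GraftTree} (h : AllOrder3 M) :
    ∃ L, AllP4OrClaw L ∧ List.Forall₂ IsBranch L M := by
  induction M with
  | nil => exact ⟨[], by simp [AllP4OrClaw], List.Forall₂.nil⟩
  | cons t M ih =>
    obtain ⟨L, hL, hM⟩ := ih fun s hs => h s (List.mem_cons_of_mem _ hs)
    obtain rfl | rfl := h t List.mem_cons_self
    · exact ⟨leafPath 4 :: L, List.forall_mem_cons.2 ⟨Or.inl rfl, hL⟩,
        List.Forall₂.cons leafPath_four_isBranch hM⟩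
    · exact ⟨leafClaw :: L, List.forall_mem_cons.2 ⟨Or.inr rfl, hL⟩,
        List.Forall₂.cons leafClaw_isBranch hM⟩

end PointedGraph

/-! ### Decomposition of graphs along bridges -/

theorem GraftTree.children_ofChildren (L : List GraftTree) : (ofChildren L).children = L := by
  induction L using List.reverseRecOn with
  | nil => rfl
  | append_singleton L t ih =>
    rw [ofChildren] at ih
    simp [ofChildren, children, ih]

theorem GraftTree.toPointed_ofChildren (L : List GraftTree) :
    (ofChildren L).toPointed = PointedGraph.point.attach L := by
  rw [toPointed_eq_attach, children_ofChildren]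

section Decomposition

variable {V : Type u} {G : SimpleGraph V}

theorem SimpleGraph.IsBridge.induce {a b : V} (h : G.IsBridge s(a, b)) {A : Set V} (ha : a ∈ A)
    (hb : b ∈ A) : (G.induce A).IsBridge s(⟨a, ha⟩, ⟨b, hb⟩) := by
  rw [isBridge_iff_forall_walk_mem_edges] at h ⊢
  intro p
  let φ : G.induce A →g G := ⟨Subtype.val, fun h => h⟩
  have hp := h (p.map φ)
  rw [Walk.edges_map, List.mem_map] at hp
  obtain ⟨e, he, hab⟩ := hp
  have : Sym2.map (Subtype.val : A → V) e = Sym2.map Subtype.val s(⟨a, ha⟩, ⟨b, hb⟩) := hab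
  rwa [← Sym2.map.injective Subtype.val_injective this]

theorem connected_induce_reachable {H : SimpleGraph V} (hHG : H ≤ G) (s : V) :
    (G.induce {x | H.Reachable s x}).Connected := by
  rw [connected_iff_exists_forall_reachable]
  refine ⟨⟨s, Reachable.refl s⟩, ?_⟩
  rintro ⟨x, hx⟩
  have key : ∀ y, Relation.ReflTransGen H.Adj s y → ∀ hy : H.Reachable s y,
      (G.induce {x | H.Reachable s x}).Reachable ⟨s, Reachable.refl s⟩ ⟨y, hy⟩ := by
    intro y h
    induction h with
    | refl => exact fun _ => Reachable.refl _
    | @tail y z h1 h2 ih =>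
      intro hz
      have hy : H.Reachable s y := (reachable_iff_reflTransGen s y).2 h1
      refine (ih hy).trans (Adj.reachable ?_)
      exact hHG h2
  exact key x ((reachable_iff_reflTransGen s x).1 hx) hx

/-- Deleting a bridge of a connected graph leaves exactly the components of its two ends, and the
bridge is the only edge across. -/
theorem pointedIso_joinByEdge_of_isBridge (hG : G.Connected) {w v : V} (hadj : G.Adj w v)
    (hb : G.IsBridge s(w, v)) :
    PointedIso G w
      (joinByEdge (G.induce {x | (G.deleteEdges {s(w, v)}).Reachable w x})
        (G.induce {x | (G.deleteEdges {s(w, v)}).Reachable v x})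
        ⟨w, Reachable.refl w⟩ ⟨v, Reachable.refl v⟩)
      (Sum.inl ⟨w, Reachable.refl w⟩) := by
  set G' := G.deleteEdges {s(w, v)} with hG'
  rw [isBridge_iff] at hb
  have hcases : ∀ x, G'.Reachable w x ∨ G'.Reachable v x := by
    intro x
    have hx := (reachable_iff_reflTransGen w x).1 (hG.preconnected w x)
    induction hx with
    | refl => exact Or.inl (Reachable.refl w)
    | @tail y z _ h2 ih =>
      by_cases he : s(y, z) = s(w, v)
      · rw [Sym2.eq_iff] at he
        obtain ⟨-, rfl⟩ | ⟨-, rfl⟩ := he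
        · exact Or.inr (Reachable.refl _)
        · exact Or.inl (Reachable.refl _)
      · have : G'.Adj y z := by
          rw [hG', deleteEdges_adj]
          exact ⟨h2, he⟩
        exact ih.imp (fun h => h.trans this.reachable) fun h => h.trans this.reachable
  have hdisj : ∀ x, G'.Reachable w x → ¬ G'.Reachable v x := fun x h1 h2 => hb (h1.trans h2.symm)
  have hcross : ∀ a b, G'.Reachable w a → G'.Reachable v b → (G.Adj a b ↔ a = w ∧ b = v) := by
    intro a b ha hb'
    constructor
    · intro hab
      by_cases he : s(a, b) = s(w, v)
      · rw [Sym2.eq_iff] at he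
        obtain h | ⟨rfl, rfl⟩ := he
        · exact h
        · exact absurd ha hb
      · have : G'.Adj a b := by
          rw [hG', deleteEdges_adj]
          exact ⟨hab, he⟩
        exact absurd hb' (hdisj b (ha.trans this.reachable))
    · rintro ⟨rfl, rfl⟩
      exact hadj
  apply PointedIso.symm
  refine ⟨⟨Equiv.ofBijective (Sum.elim Subtype.val Subtype.val) ⟨?_, ?_⟩, ?_⟩, rfl⟩
  · rintro (⟨a, ha⟩ | ⟨a, ha⟩) (⟨b, hb'⟩ | ⟨b, hb'⟩) hab <;>
      simp only [Sum.elim_inl, Sum.elim_inr] at hab <;> subst hab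
    · rfl
    · exact absurd hb' (hdisj _ ha)
    · exact absurd ha (hdisj _ hb')
    · rfl
  · intro x
    obtain h | h := hcases x
    · exact ⟨Sum.inl ⟨x, h⟩, rfl⟩
    · exact ⟨Sum.inr ⟨x, h⟩, rfl⟩
  · rintro (⟨a, ha⟩ | ⟨a, ha⟩) (⟨b, hb'⟩ | ⟨b, hb'⟩)
    · simp
    · simpa using hcross a b ha hb'
    · simpa [G.adj_comm a b] using hcross b a hb' ha
    · simp

theorem pointedIso_induce_induce {A K : Set V} (hKA : K ⊆ A) {w : V} (hw : w ∈ K) :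
    PointedIso ((G.induce A).induce (Subtype.val ⁻¹' K : Set A)) ⟨⟨w, hKA hw⟩, hw⟩
      (G.induce K) ⟨w, hw⟩ :=
  ⟨⟨⟨fun x => ⟨x.1.1, x.2⟩, fun x => ⟨⟨x.1, hKA x.2⟩, x.2⟩, fun _ => rfl, fun _ => rfl⟩, Iff.rfl⟩,
    rfl⟩

/-- A connected graph, all of whose edges outside a part `K` are bridges and whose edges leaving `K`
all start at the same vertex `w`, arises from `K` by attaching rooted trees at `w`. -/
theorem exists_pointedIso_attach (N : ℕ) {V : Type u} [Finite V] (hN : Nat.card V ≤ N)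
    (G : SimpleGraph V) (hG : G.Connected) (K : Set V) {w : V} (hw : w ∈ K) (P : PointedGraph)
    (hP : P.graph.Connected) (hKP : PointedIso (G.induce K) ⟨w, hw⟩ P.graph P.root)
    (hleave : ∀ a ∈ K, ∀ b ∉ K, G.Adj a b → a = w)
    (hbridge : ∀ a b, G.Adj a b → ¬ (a ∈ K ∧ b ∈ K) → G.IsBridge s(a, b)) :
    ∃ ts, PointedIso G w (P.attach ts).graph (P.attach ts).root := by
  induction N generalizing V P with
  | zero =>
    have : Nonempty V := ⟨w⟩
    have := Nat.card_pos (α := V)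
    omega
  | succ N ih =>
    by_cases hK : K = Set.univ
    · subst hK
      refine ⟨[], PointedIso.trans ?_ hKP⟩
      exact PointedIso.symm ⟨induceUnivIso G, rfl⟩
    obtain ⟨x, hx⟩ := (Set.ne_univ_iff_exists_notMem K).1 hK
    obtain ⟨p⟩ := hG.preconnected w x
    -- A walk from `w` to a vertex outside `K` must leave `K`, and by `hleave` it does so along an
    -- edge at `w`.
    obtain ⟨d, -, hd1, hd2⟩ := p.exists_boundary_dart K hw hx
    obtain ⟨⟨w', v⟩, hadj⟩ := d
    simp only at hd1 hd2
    obtain rfl := hleave w' hd1 v hd2 hadj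
    have hb := hbridge w' v hadj fun h => hd2 h.2
    have hiso := pointedIso_joinByEdge_of_isBridge hG hadj hb
    have hdis := isBridge_iff.1 hb
    set G' := G.deleteEdges {s(w', v)} with hG'
    have hle : G' ≤ G := deleteEdges_le _
    -- `K` is connected and does not contain the bridge, so it stays on the side of `w`.
    have hKA : K ⊆ {x | G'.Reachable w' x} := by
      intro y hy
      have hconn : (G.induce K).Connected := by
        obtain ⟨e, -⟩ := hKP
        exact (e.connected_iff).2 hP
      have hr := hconn.preconnected ⟨w', hw⟩ ⟨y, hy⟩
      let φ : G.induce K →g G' := ⟨Subtype.val, by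
        rintro ⟨a, ha⟩ ⟨b, hb'⟩ hab
        rw [hG', deleteEdges_adj]
        refine ⟨hab, fun he => ?_⟩
        rw [Set.mem_singleton_iff, Sym2.eq_iff] at he
        obtain ⟨-, rfl⟩ | ⟨rfl, -⟩ := he
        · exact hd2 hb'
        · exact hd2 ha⟩
      exact hr.map φ
    have hBK : ∀ y, G'.Reachable v y → y ∉ K := fun y hy hyK => hdis ((hKA hyK).trans hy.symm)
    have hcardA : Nat.card {x | G'.Reachable w' x} < Nat.card V :=
      Finite.card_subtype_lt (x := v) hdis
    have hcardB : Nat.card {x | G'.Reachable v x} < Nat.card V :=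
      Finite.card_subtype_lt (x := w') fun h => hdis (Reachable.symm h)
    -- Induction on both sides: the side of `w` keeps the part `K`, and the side of `v` takes the
    -- single vertex `v` as its part, which makes it a rooted tree.
    obtain ⟨ts, hts⟩ := ih (by omega) (G.induce {x | G'.Reachable w' x})
      (connected_induce_reachable hle w') (Subtype.val ⁻¹' K) (w := ⟨w', Reachable.refl w'⟩) hw P hP
      ((pointedIso_induce_induce hKA hw).trans hKP)
      (fun a ha b hb' hab => Subtype.ext (hleave a ha b hb' hab))
      (fun a b hab h => (hbridge a b hab h).induce a.2 b.2)
    obtain ⟨us, hus⟩ := ih (by omega) (G.induce {x | G'.Reachable v x})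
      (connected_induce_reachable hle v) {⟨v, Reachable.refl v⟩} (w := ⟨v, Reachable.refl v⟩) rfl
      PointedGraph.point (by
        show (⊥ : SimpleGraph Unit).Connected
        exact connected_iff_exists_forall_reachable _ |>.2 ⟨(), fun _ => Reachable.refl _⟩)
      (by
        show PointedIso _ _ (⊥ : SimpleGraph Unit) ()
        refine ⟨⟨⟨fun _ => (), fun _ => ⟨⟨v, Reachable.refl v⟩, rfl⟩, ?_, fun _ => rfl⟩, ?_⟩, rfl⟩
        · rintro ⟨a, rfl⟩
          rfl
        · rintro ⟨a, rfl⟩ ⟨b, rfl⟩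
          simp)
      (fun a ha b _ _ => ha)
      (fun a b hab _ => (hbridge a b hab fun h => hBK a a.2 h.1).induce a.2 b.2)
    refine ⟨ts ++ [ofChildren us], hiso.trans ?_⟩
    have : P.attach (ts ++ [ofChildren us]) = (P.attach ts).graft (PointedGraph.point.attach us) := by
      rw [PointedGraph.attach, List.foldl_append, ← toPointed_ofChildren]
      rfl
    rw [this]
    exact hts.joinByEdge hus

end Decomposition

/-! ### Potted graphs are cycles with trees attached at one vertex -/

theorem cycleGraph_adj_iff_val {m : ℕ} (hm : 3 ≤ m) (i j : Fin m) :
    (cycleGraph m).Adj i j ↔ j.val = i.val + 1 ∨ i.val = j.val + 1 ∨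
      (i.val = 0 ∧ j.val + 1 = m) ∨ (j.val = 0 ∧ i.val + 1 = m) := by
  obtain ⟨i, hi⟩ := i
  obtain ⟨j, hj⟩ := j
  rw [cycleGraph_adj', Fin.sub_def, Fin.sub_def]
  simp only
  rcases lt_or_ge i j with h | h
  · rw [Nat.mod_eq_of_lt (by omega : m - j + i < m),
      (by omega : m - i + j = j - i + m), Nat.add_mod_right, Nat.mod_eq_of_lt (by omega)]
    omega
  · rw [(by omega : m - j + i = i - j + m), Nat.add_mod_right, Nat.mod_eq_of_lt (by omega)]
    rcases h.eq_or_lt with rfl | h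
    · rw [Nat.sub_add_cancel hi.le, Nat.mod_self]
      omega
    · rw [Nat.mod_eq_of_lt (by omega)]
      omega

section UniqueCycle

variable {V : Type u} {G : SimpleGraph V} {v : V} {p : G.Walk v v}

/-- A chord would close up with a path along the cycle to a second cycle. -/
theorem toSubgraph_adj_of_unique_cycle
    (hu : ∀ (x : V) (q : G.Walk x x), q.IsCycle → q.toSubgraph = p.toSubgraph) {a b : V}
    (ha : a ∈ p.toSubgraph.verts) (hb : b ∈ p.toSubgraph.verts) (hab : G.Adj a b) :
    p.toSubgraph.Adj a b := by
  by_contra hn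
  have hr := p.toSubgraph_connected.preconnected ⟨a, ha⟩ ⟨b, hb⟩
  let φ : p.toSubgraph.coe →g G.deleteEdges {s(a, b)} := ⟨Subtype.val, by
    rintro ⟨x, hx⟩ ⟨y, hy⟩ hxy
    have hxy' : p.toSubgraph.Adj x y := hxy
    rw [deleteEdges_adj]
    refine ⟨hxy'.adj_sub, fun he => hn ?_⟩
    rw [Set.mem_singleton_iff, Sym2.eq_iff] at he
    obtain ⟨rfl, rfl⟩ | ⟨rfl, rfl⟩ := he
    · exact hxy'
    · exact hxy'.symm⟩
  obtain ⟨x, q, hq, he⟩ := adj_and_reachable_delete_edges_iff_exists_cycle.1 ⟨hab, hr.map φ⟩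
  rw [← Walk.adj_toSubgraph_iff_mem_edges, hu x q hq] at he
  exact hn he

theorem isBridge_of_unique_cycle
    (hu : ∀ (x : V) (q : G.Walk x x), q.IsCycle → q.toSubgraph = p.toSubgraph) {a b : V}
    (hab : G.Adj a b) (h : ¬ (a ∈ p.toSubgraph.verts ∧ b ∈ p.toSubgraph.verts)) :
    G.IsBridge s(a, b) := by
  rw [isBridge_iff_forall_cycle_notMem hab]
  intro x q hq he
  rw [← Walk.adj_toSubgraph_iff_mem_edges, hu x q hq] at he
  exact h ⟨he.fst_mem, he.snd_mem⟩

/-- Two neighbours on the cycle and one outside it. In a potted graph, edges therefore leave the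
cycle only at `w`. -/
theorem two_lt_ncard_neighborSet_of_isCycle [Finite V] (hp : p.IsCycle) {a b : V}
    (ha : a ∈ p.toSubgraph.verts) (hb : b ∉ p.toSubgraph.verts) (hab : G.Adj a b) :
    2 < (G.neighborSet a).ncard := by
  rw [← hp.ncard_neighborSet_toSubgraph_eq_two (p.mem_verts_toSubgraph.1 ha)]
  refine Set.ncard_lt_ncard ⟨p.toSubgraph.neighborSet_subset a, fun h => hb ?_⟩ (Set.toFinite _)
  have : p.toSubgraph.Adj a b := h hab
  exact this.snd_mem

theorem getVert_eq_getVert_iff_of_isCycle (hp : p.IsCycle) {i j : ℕ} (hi : i < p.length)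
    (hj : j < p.length) : p.getVert i = p.getVert j ↔ i = j :=
  ⟨fun h => hp.getVert_injOn' (by simp only [Set.mem_ofPred_eq]; omega)
    (by simp only [Set.mem_ofPred_eq]; omega) h, fun h => h ▸ rfl⟩

theorem toSubgraph_adj_getVert_iff (hp : p.IsCycle) (i j : Fin p.length) :
    p.toSubgraph.Adj (p.getVert i) (p.getVert j) ↔ (cycleGraph p.length).Adj i j := by
  have h3 := hp.three_le_length
  have hend : p.getVert p.length = p.getVert 0 := by simp
  have hinj := fun {i j : ℕ} => getVert_eq_getVert_iff_of_isCycle hp (i := i) (j := j)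
  rw [cycleGraph_adj_iff_val h3, Walk.toSubgraph_adj_iff]
  obtain ⟨i, hi⟩ := i
  obtain ⟨j, hj⟩ := j
  -- Position l + 1 may equal `p.length`, where the closed walk is back at position 0.
  have key : ∀ l < p.length, ∀ a < p.length, (p.getVert (l + 1) = p.getVert a ↔
      (l + 1 = a ∨ l + 1 = p.length ∧ a = 0)) := by
    intro l hl a ha
    rcases Nat.lt_or_ge (l + 1) p.length with h | h
    · rw [hinj h ha]
      omega
    · rw [(by omega : l + 1 = p.length), hend, hinj (by omega) ha]
      omega
  simp only [Sym2.eq_iff]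
  constructor
  · rintro ⟨l, h, hl⟩
    rw [hinj hl hi, hinj hl hj, key l hl j hj, key l hl i hi] at h
    omega
  · have hk : ∀ l < p.length, ((l = i ∧ (l + 1 = j ∨ l + 1 = p.length ∧ j = 0)) ∨
        (l = j ∧ (l + 1 = i ∨ l + 1 = p.length ∧ i = 0))) →
        ∃ l, (p.getVert l = p.getVert i ∧ p.getVert (l + 1) = p.getVert j ∨
          p.getVert l = p.getVert j ∧ p.getVert (l + 1) = p.getVert i) ∧ l < p.length := by
      intro l hl h
      refine ⟨l, ?_, hl⟩
      rwa [hinj hl hi, hinj hl hj, key l hl j hj, key l hl i hi]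
    rintro (h | h | h | h)
    · exact hk i hi (by omega)
    · exact hk j hj (by omega)
    · exact hk j hj (by omega)
    · exact hk i hi (by omega)

theorem exists_iso_cycleGraph_of_unique_cycle (hp : p.IsCycle)
    (hu : ∀ (x : V) (q : G.Walk x x), q.IsCycle → q.toSubgraph = p.toSubgraph) :
    Nonempty (cycleGraph p.length ≃g G.induce p.toSubgraph.verts) := by
  have h3 := hp.three_le_length
  have hmem : ∀ i, p.getVert i ∈ p.toSubgraph.verts := fun i =>
    p.mem_verts_toSubgraph.2 (p.getVert_mem_support i)
  refine ⟨⟨Equiv.ofBijective (fun i : Fin p.length => ⟨p.getVert i, hmem i⟩) ⟨?_, ?_⟩, ?_⟩⟩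
  · intro i j h
    exact Fin.ext ((getVert_eq_getVert_iff_of_isCycle hp i.2 j.2).1 (congrArg Subtype.val h))
  · rintro ⟨x, hx⟩
    obtain ⟨i, rfl, hi⟩ := (Walk.mem_support_iff_exists_getVert).1 (p.mem_verts_toSubgraph.1 hx)
    rcases hi.eq_or_lt with rfl | hi
    · exact ⟨⟨0, by omega⟩, Subtype.ext (by simp)⟩
    · exact ⟨⟨i, hi⟩, rfl⟩
  · intro i j
    rw [← toSubgraph_adj_getVert_iff hp]
    exact ⟨toSubgraph_adj_of_unique_cycle hu (hmem i) (hmem j), fun h => h.adj_sub⟩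

end UniqueCycle

/-- The cycle `C_k` with a distinguished vertex. -/
def pointedCycle (k : ℕ) (c : Fin k) : PointedGraph := ⟨Fin k, cycleGraph k, c⟩

theorem IsPotted.exists_pointedIso {V : Type u} [Fintype V] {G : SimpleGraph V} {n k : ℕ}
    (h : IsPotted G n k) : 3 ≤ k ∧ ∃ (c : Fin k) (ts : List GraftTree) (w : V),
      PointedIso G w ((pointedCycle k c).attach ts).graph ((pointedCycle k c).attach ts).root := by
  obtain ⟨-, hconn, C, ⟨v, p, hp, rfl⟩, huniq, hk, w, ⟨hw, -⟩, hw'⟩ := h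
  have hu : ∀ (x : V) (q : G.Walk x x), q.IsCycle → q.toSubgraph = p.toSubgraph :=
    fun x q hq => huniq _ ⟨x, q, hq, rfl⟩
  obtain ⟨e⟩ := exists_iso_cycleGraph_of_unique_cycle hp hu
  have hlen : p.length = k := by
    rw [← hk, ← Nat.card_coe_set_eq, ← Nat.card_congr e.toEquiv, Nat.card_fin]
  subst hlen
  have h3 := hp.three_le_length
  refine ⟨h3, e.symm ⟨w, hw⟩, ?_⟩
  obtain ⟨ts, hts⟩ := exists_pointedIso_attach (Nat.card V) le_rfl G hconn p.toSubgraph.verts hw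
    (pointedCycle p.length (e.symm ⟨w, hw⟩)) (by
      obtain ⟨m, hm⟩ : ∃ m, p.length = m + 1 := ⟨p.length - 1, by omega⟩
      show (cycleGraph p.length).Connected
      rw [hm]
      exact cycleGraph_connected)
    ⟨e.symm, rfl⟩
    (fun a ha b hb hab => hw' a ⟨ha, two_lt_ncard_neighborSet_of_isCycle hp ha hb hab⟩)
    (fun a b hab h => isBridge_of_unique_cycle hu hab h)
  exact ⟨ts, w, hts⟩

/-! ### Maximum dissociation sets of cycles of length divisible by three -/

section PeriodicSums

theorem sum_range_three_mul (f : ℕ → ℕ) (m : ℕ) : ∑ i ∈ Finset.range (3 * m), f i =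
    ∑ j ∈ Finset.range m, (f (3 * j) + f (3 * j + 1) + f (3 * j + 2)) := by
  induction m with
  | zero => rfl
  | succ m ih =>
    rw [Finset.sum_range_succ, ← ih, (by ring : 3 * (m + 1) = 3 * m + 1 + 1 + 1),
      Finset.sum_range_succ, Finset.sum_range_succ, Finset.sum_range_succ]
    ring

theorem sum_range_add_of_periodic {f : ℕ → ℕ} {k : ℕ} (h : ∀ i, f (i + k) = f i) (s : ℕ) :
    ∑ i ∈ Finset.range k, f (i + s) = ∑ i ∈ Finset.range k, f i := by
  induction s with
  | zero => rfl
  | succ s ih =>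
    rw [← ih]
    have h1 := Finset.sum_range_succ (fun i => f (i + s)) k
    have h2 := Finset.sum_range_succ' (fun i => f (i + s)) k
    have h3 : f (k + s) = f (0 + s) := by rw [add_comm k s, h, zero_add]
    have h4 : ∑ i ∈ Finset.range k, f (i + (s + 1)) = ∑ i ∈ Finset.range k, f (i + 1 + s) :=
      Finset.sum_congr rfl fun i _ => by rw [add_right_comm, add_assoc]
    omega

theorem sum_range_three_mul_le {f : ℕ → ℕ} (h : ∀ i, f i + f (i + 1) + f (i + 2) ≤ 2) (m : ℕ) :
    ∑ i ∈ Finset.range (3 * m), f i ≤ 2 * m := by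
  rw [sum_range_three_mul]
  refine (Finset.sum_le_card_nsmul _ _ 2 fun j _ => h (3 * j)).trans ?_
  simp [mul_comm]

/-- Cut one period into m triples starting at `s`. Each has sum at most 2 and together they have sum
2m, so the first has sum 2. -/
theorem window_eq_two_of_sum_eq {f : ℕ → ℕ} {m : ℕ} (hm : 0 < m)
    (hper : ∀ i, f (i + 3 * m) = f i) (h : ∀ i, f i + f (i + 1) + f (i + 2) ≤ 2)
    (hsum : ∑ i ∈ Finset.range (3 * m), f i = 2 * m) (s : ℕ) :
    f s + f (s + 1) + f (s + 2) = 2 := by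
  have hs := sum_range_add_of_periodic hper s
  rw [hsum, sum_range_three_mul (fun i => f (i + s))] at hs
  have hle : ∀ j ∈ Finset.range m,
      f (3 * j + s) + f (3 * j + 1 + s) + f (3 * j + 2 + s) ≤ 2 := by
    intro j _
    have := h (3 * j + s)
    rwa [add_right_comm (3 * j) s 1, add_right_comm (3 * j) s 2] at this
  have heq := (Finset.sum_eq_sum_iff_of_le hle).1 (by simpa [mul_comm] using hs) 0
    (Finset.mem_range.2 hm)
  simpa [add_comm] using heq

end PeriodicSums

theorem add_one_mod_eq_ite {k : ℕ} (hk : 1 < k) (i : ℕ) :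
    (i + 1) % k = if i % k + 1 = k then 0 else i % k + 1 := by
  have hlt := Nat.mod_lt i (by omega : 0 < k)
  rw [Nat.add_mod, Nat.mod_eq_of_lt hk]
  split_ifs with h
  · rw [h, Nat.mod_self]
  · exact Nat.mod_eq_of_lt (by omega)

section Cycle

variable {m : ℕ}

/-- The indicator function of a set of vertices of a cycle, extended periodically. -/
def periodicIndicator (hm : 0 < m) (S : Finset (Fin (3 * m))) (i : ℕ) : ℕ :=
  if (⟨i % (3 * m), Nat.mod_lt _ (by omega)⟩ : Fin (3 * m)) ∈ S then 1 else 0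

theorem periodicIndicator_val (hm : 0 < m) (S : Finset (Fin (3 * m))) (i : Fin (3 * m)) :
    periodicIndicator hm S i = if i ∈ S then 1 else 0 := by
  simp [periodicIndicator, Nat.mod_eq_of_lt i.2]

theorem sum_periodicIndicator (hm : 0 < m) (S : Finset (Fin (3 * m))) :
    ∑ i ∈ Finset.range (3 * m), periodicIndicator hm S i = S.card := by
  rw [← Fin.sum_univ_eq_sum_range]
  simp [periodicIndicator_val]

/-- Three consecutive chosen vertices would give the middle one two neighbours. -/
theorem periodicIndicator_window (hm : 0 < m) {S : Finset (Fin (3 * m))}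
    (hS : Dissociated (cycleGraph (3 * m)) S) (i : ℕ) :
    periodicIndicator hm S i + periodicIndicator hm S (i + 1) + periodicIndicator hm S (i + 2)
      ≤ 2 := by
  have hk : 0 < 3 * m := by omega
  by_contra! h
  have h1 : ∀ j, periodicIndicator hm S j ≤ 1 := by
    intro j
    rw [periodicIndicator]
    split_ifs <;> simp
  have h2 : ∀ j, periodicIndicator hm S j = 1 →
      (⟨j % (3 * m), Nat.mod_lt _ hk⟩ : Fin (3 * m)) ∈ S := by
    intro j hj
    by_contra hn
    simp [periodicIndicator, hn] at hj
  have ha := h2 i (by have := h1 i; have := h1 (i + 1); have := h1 (i + 2); omega)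
  have hb := h2 (i + 1) (by have := h1 i; have := h1 (i + 1); have := h1 (i + 2); omega)
  have hc := h2 (i + 2) (by have := h1 i; have := h1 (i + 1); have := h1 (i + 2); omega)
  have hlt := Nat.mod_lt i hk
  have e1 := add_one_mod_eq_ite (by omega : 1 < 3 * m) i
  have e2 := add_one_mod_eq_ite (by omega : 1 < 3 * m) (i + 1)
  have := hS _ hb _ ha _ hc ((cycleGraph_adj_iff_val (by omega) _ _).2 (by
      simp only
      split_ifs at e1 <;> omega)) ((cycleGraph_adj_iff_val (by omega) _ _).2 (by
      simp only [(by ring : i + 2 = i + 1 + 1)]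
      split_ifs at e2 <;> omega))
  rw [Fin.mk.injEq, (by ring : i + 2 = i + 1 + 1)] at this
  split_ifs at e1 e2 <;> omega

/-- The vertices of a cycle outside a residue class modulo three. -/
def residueSet (m j : ℕ) : Finset (Fin (3 * m)) := Finset.univ.filter fun i => i.val % 3 ≠ j

@[simp] theorem mem_residueSet {j : ℕ} {i : Fin (3 * m)} :
    i ∈ residueSet m j ↔ i.val % 3 ≠ j := by simp [residueSet]

theorem card_residueSet {j : ℕ} (hj : j < 3) : (residueSet m j).card = 2 * m := by
  rw [residueSet, Finset.card_filter,
    Fin.sum_univ_eq_sum_range (fun i => if i % 3 ≠ j then 1 else 0), sum_range_three_mul]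
  have : ∀ l ∈ Finset.range m, ((if 3 * l % 3 ≠ j then 1 else 0) +
      (if (3 * l + 1) % 3 ≠ j then 1 else 0) + (if (3 * l + 2) % 3 ≠ j then 1 else 0)) = 2 := by
    intro l _
    split_ifs <;> omega
  rw [Finset.sum_congr rfl this]
  simp [mul_comm]

theorem dissociated_residueSet (hm : 0 < m) {j : ℕ} (hj : j < 3) :
    Dissociated (cycleGraph (3 * m)) (residueSet m j) := by
  intro a ha b hb c hc hab hac
  rw [cycleGraph_adj_iff_val (by omega)] at hab hac
  rw [mem_residueSet] at ha hb hc
  have := a.2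
  have := b.2
  have := c.2
  ext
  omega

theorem residueSet_injective (hm : 0 < m) {i j : ℕ} (hi : i < 3)
    (h : residueSet m i = residueSet m j) : i = j := by
  by_contra hn
  have h1 : (⟨i, by omega⟩ : Fin (3 * m)) ∈ residueSet m j := by
    rw [mem_residueSet]
    simp only
    omega
  rw [← h, mem_residueSet] at h1
  simp only at h1
  omega

theorem card_le_of_dissociated_cycleGraph (hm : 0 < m) {S : Finset (Fin (3 * m))}
    (hS : Dissociated (cycleGraph (3 * m)) S) : S.card ≤ 2 * m := by
  rw [← sum_periodicIndicator hm]
  exact sum_range_three_mul_le (periodicIndicator_window hm hS) m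

/-- At the maximum every window of three has sum 2. Comparing consecutive windows shows that the
indicator has period 3, so it is determined by the one vertex omitted among the first three. -/
theorem dissociated_cycleGraph_iff (hm : 0 < m) (S : Finset (Fin (3 * m))) :
    Dissociated (cycleGraph (3 * m)) S ∧ S.card = 2 * m ↔ ∃ j < 3, S = residueSet m j := by
  constructor
  · rintro ⟨hS, hcard⟩
    have hwin := window_eq_two_of_sum_eq hm (f := periodicIndicator hm S)
      (fun i => by simp [periodicIndicator]) (periodicIndicator_window hm hS)
      (by rw [sum_periodicIndicator, hcard])
    have hper : Function.Periodic (periodicIndicator hm S) 3 := by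
      intro i
      have h1 := hwin i
      have h2 := hwin (i + 1)
      rw [(by ring : i + 3 = i + 1 + 2)]
      rw [(by ring : i + 1 + 1 = i + 2)] at h2
      omega
    have hle : ∀ i, periodicIndicator hm S i ≤ 1 := by
      intro i
      rw [periodicIndicator]
      split_ifs <;> simp
    have hmem : ∀ i : Fin (3 * m), i ∈ S ↔ periodicIndicator hm S (i.val % 3) = 1 := by
      intro i
      rw [hper.map_mod_nat, periodicIndicator_val]
      simp
    have h0 := hwin 0
    rw [zero_add, zero_add] at h0
    have hl0 := hle 0
    have hl1 := hle 1
    have hl2 := hle 2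
    obtain ⟨j, hj, hzero, hone⟩ : ∃ j < 3, periodicIndicator hm S j = 0 ∧
        ∀ i < 3, i ≠ j → periodicIndicator hm S i = 1 := by
      rcases Nat.lt_or_ge 0 (periodicIndicator hm S 0) with p0 | p0
      · rcases Nat.lt_or_ge 0 (periodicIndicator hm S 1) with p1 | p1
        · refine ⟨2, by omega, by omega, fun i hi hne => ?_⟩
          interval_cases i <;> omega
        · refine ⟨1, by omega, by omega, fun i hi hne => ?_⟩
          interval_cases i <;> omega
      · refine ⟨0, by omega, by omega, fun i hi hne => ?_⟩
        interval_cases i <;> omega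
    refine ⟨j, hj, ?_⟩
    ext i
    rw [hmem, mem_residueSet]
    refine ⟨fun h he => ?_, hone _ (Nat.mod_lt _ (by omega))⟩
    rw [he] at h
    omega
  · rintro ⟨j, hj, rfl⟩
    exact ⟨dissociated_residueSet hm hj, card_residueSet hj⟩

/-- The residues of `c` and its two neighbours are distinct mod 3, so at most one neighbour is
omitted: the successor serves as a partner unless it is the omitted one, and then the predecessor
does. -/
theorem not_isolatedFrom_residueSet (hm : 0 < m) (c : Fin (3 * m)) {j : ℕ}
    (hc : c ∈ residueSet m j) : ¬ IsolatedFrom (cycleGraph (3 * m)) c (residueSet m j) := by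
  intro h
  have hlt := c.2
  rw [mem_residueSet] at hc
  by_cases h1 : (c.val + 1) % 3 = j
  · by_cases h0 : c.val = 0
    · refine h ⟨3 * m - 1, by omega⟩ ?_ ((cycleGraph_adj_iff_val (by omega) _ _).2 ?_)
      · rw [mem_residueSet]
        simp only
        omega
      · simp only
        omega
    · refine h ⟨c.val - 1, by omega⟩ ?_ ((cycleGraph_adj_iff_val (by omega) _ _).2 ?_)
      · rw [mem_residueSet]
        simp only
        omega
      · simp only
        omega
  · by_cases h0 : c.val + 1 = 3 * m
    · refine h ⟨0, by omega⟩ ?_ ((cycleGraph_adj_iff_val (by omega) _ _).2 ?_)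
      · rw [mem_residueSet]
        simp only
        omega
      · exact Or.inr (Or.inr (Or.inr ⟨rfl, h0⟩))
    · refine h ⟨c.val + 1, by omega⟩ ?_ ((cycleGraph_adj_iff_val (by omega) _ _).2 ?_)
      · rw [mem_residueSet]
        simpa only
      · exact Or.inl rfl

open scoped Classical in
theorem topCoeff_setPoly {V : Type*} [Fintype V] {p : Finset V → Prop} {d k : ℕ}
    (h : ∀ S, p S → S.card ≤ d) {F : Finset (Finset V)} (hF : ∀ S, S ∈ F ↔ p S ∧ S.card = d)
    (hk : F.card = k) : TopCoeff (setPoly p) d k := by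
  refine ⟨Polynomial.natDegree_le_iff_coeff_eq_zero.2 fun N hN => ?_, ?_⟩
  · rw [coeff_setPoly, Finset.card_eq_zero, Finset.filter_eq_empty_iff]
    rintro S - ⟨hS, rfl⟩
    exact absurd (h S hS) (by omega)
  · rw [coeff_setPoly, ← hk]
    congr 1
    ext S
    simp [hF]

/-- Of the three maximum sets, the one omitting the residue class of `c` avoids `c`, and `c` is
matched in the other two. -/
theorem hasRootCount_cycleGraph (hm : 0 < m) (c : Fin (3 * m)) :
    HasRootCount (cycleGraph (3 * m)) c ⟨.free, 1, 0, 2⟩ := by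
  classical
  refine ⟨2 * m, ?_, ?_, ?_⟩
  · refine topCoeff_setPoly (F := {residueSet m (c.val % 3)})
      (fun S hS => card_le_of_dissociated_cycleGraph hm hS.1) (fun S => ?_) rfl
    rw [Finset.mem_singleton, and_right_comm]
    refine Iff.trans ?_ (and_congr_left' (dissociated_cycleGraph_iff hm S).symm)
    constructor
    · rintro rfl
      exact ⟨⟨_, Nat.mod_lt _ (by omega), rfl⟩, fun h => mem_residueSet.1 h rfl⟩
    · rintro ⟨⟨j, -, rfl⟩, h⟩
      have h : c.val % 3 = j := by
        by_contra hn
        exact h (mem_residueSet.2 hn)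
      rw [h]
  · refine topCoeff_setPoly (F := ∅)
      (fun S hS => card_le_of_dissociated_cycleGraph hm hS.1) (fun S => ?_) rfl
    simp only [Finset.notMem_empty, false_iff]
    rintro ⟨⟨hS, hc, hi⟩, hcard⟩
    obtain ⟨j, -, rfl⟩ := (dissociated_cycleGraph_iff hm S).1 ⟨hS, hcard⟩
    exact not_isolatedFrom_residueSet hm c hc hi
  · refine topCoeff_setPoly
      (F := {residueSet m ((c.val + 1) % 3), residueSet m ((c.val + 2) % 3)})
      (fun S hS => card_le_of_dissociated_cycleGraph hm hS.1) (fun S => ?_)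
      (Finset.card_pair fun h => ?_)
    · rw [and_right_comm]
      refine Iff.trans ?_ (and_congr_left' (dissociated_cycleGraph_iff hm S).symm)
      rw [Finset.mem_insert, Finset.mem_singleton]
      constructor
      · have key : ∀ j < 3, c.val % 3 ≠ j → (∃ i < 3, residueSet m j = residueSet m i) ∧
            c ∈ residueSet m j ∧
              ¬ IsolatedFrom (cycleGraph (3 * m)) c (residueSet m j) := fun j hj hc =>
          ⟨⟨j, hj, rfl⟩, mem_residueSet.2 hc,
            not_isolatedFrom_residueSet hm c (mem_residueSet.2 hc)⟩
        rintro (rfl | rfl)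
        · exact key _ (Nat.mod_lt _ (by omega)) (by omega)
        · exact key _ (Nat.mod_lt _ (by omega)) (by omega)
      · rintro ⟨⟨j, hj, rfl⟩, hc, -⟩
        replace hc : c.val % 3 ≠ j := mem_residueSet.1 hc
        have : j = (c.val + 1) % 3 ∨ j = (c.val + 2) % 3 := by omega
        exact this.imp (congrArg _) (congrArg _)
    · have := residueSet_injective hm (Nat.mod_lt _ (by omega)) h
      omega

theorem pointedCycle_counted (hm : 0 < m) (c : Fin (3 * m)) :
    (pointedCycle (3 * m) c).Counted (3 * m) ⟨.free, 1, 0, 2⟩ :=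
  ⟨inferInstanceAs (Fintype (Fin (3 * m))), Fintype.card_fin _, hasRootCount_cycleGraph hm c⟩

end Cycle

/-! ### The extremal potted graphs -/

section Families

open PointedGraph

variable {V : Type u} {G : SimpleGraph V} {k : ℕ} {c : Fin k}

theorem nonempty_iso_cycleAddEdge_iff {L : List PointedGraph} {us : List GraftTree} {t : GraftTree}
    (h : List.Forall₂ IsBranch L us) (hp : t.children.Perm us) :
    Nonempty (G ≃g cycleAddEdge k c (glue L)) ↔
      Nonempty (G ≃g ((pointedCycle k c).attach [t]).graph) := by
  have key : (glue L).Iso t.toPointed := by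
    rw [toPointed_eq_attach]
    exact (glue_iso h).trans (point.attach_perm hp.symm)
  obtain ⟨e, -⟩ := (PointedIso.refl (cycleGraph k) c).joinByEdge key
  exact ⟨fun ⟨f⟩ => ⟨f.trans e⟩, fun ⟨f⟩ => ⟨f.trans e.symm⟩⟩

theorem nonempty_iso_cycleIdentify_iff {L : List PointedGraph} {us ts : List GraftTree}
    (h : List.Forall₂ IsBranch L us) (hp : ts.Perm us) :
    Nonempty (G ≃g (cycleIdentify k c (glue L)).graph) ↔
      Nonempty (G ≃g ((pointedCycle k c).attach ts).graph) := by
  obtain ⟨e, -⟩ := (glue_pair_iso (pointedCycle k c) _ (glue_iso h)).trans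
    ((pointedCycle k c).attach_perm hp.symm)
  exact ⟨fun ⟨f⟩ => ⟨f.trans e⟩, fun ⟨f⟩ => ⟨f.trans e.symm⟩⟩

theorem mem_potFamily1_iff : G ∈ potFamily1 V k ↔ ∃ (c : Fin k) (ts : List GraftTree),
    Extremal0 ts ∧ Nonempty (G ≃g ((pointedCycle k c).attach ts).graph) := by
  have hL : ∀ l, List.Forall₂ IsBranch (leafPath 3 :: List.replicate l (leafPath 4))
      (path2 :: List.replicate l path3) := fun l =>
    .cons leafPath_three_isBranch (forall₂_isBranch_replicate l)
  constructor
  · rintro ⟨_, ⟨l, rfl⟩, c, e⟩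
    have hp := List.Perm.of_eq (children_ofChildren (path2 :: List.replicate l path3))
    exact ⟨c, _, ⟨_, l, rfl, hp⟩, (nonempty_iso_cycleAddEdge_iff (hL l) hp).1 e⟩
  · rintro ⟨c, _, ⟨t, l, rfl, hp⟩, e⟩
    exact ⟨_, ⟨l, rfl⟩, c, (nonempty_iso_cycleAddEdge_iff (hL l) hp).2 e⟩

/-- Membership in a family of cycles with an additional edge to a glued tree, in terms of the
children of the root of the tree. -/
theorem mem_edgeFamily_iff {B : List PointedGraph} {bs : List GraftTree}
    (hB : List.Forall₂ IsBranch B bs) :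
    G ∈ edgeFamily V k {T | ∃ L, AllP4OrClaw L ∧ T = glue (B ++ L)} ↔
      ∃ (c : Fin k) (t : GraftTree) (M : List GraftTree), AllOrder3 M ∧
        t.children.Perm (bs ++ M) ∧ Nonempty (G ≃g ((pointedCycle k c).attach [t]).graph) := by
  constructor
  · rintro ⟨_, ⟨L, hL, rfl⟩, c, e⟩
    obtain ⟨M, hM, hLM⟩ := exists_forall₂_of_allP4OrClaw hL
    have hp := List.Perm.of_eq (children_ofChildren (bs ++ M))
    exact ⟨c, _, M, hM, hp, (nonempty_iso_cycleAddEdge_iff (List.rel_append hB hLM) hp).1 e⟩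
  · rintro ⟨c, t, M, hM, hp, e⟩
    obtain ⟨L, hL, hLM⟩ := exists_forall₂_of_allOrder3 hM
    exact ⟨_, ⟨L, hL, rfl⟩, c,
      (nonempty_iso_cycleAddEdge_iff (List.rel_append hB hLM) hp).2 e⟩

theorem mem_identifyFamily_iff {B : List PointedGraph} {bs : List GraftTree}
    (hB : List.Forall₂ IsBranch B bs) :
    (∃ L, AllP4OrClaw L ∧ ∃ c : Fin k,
        Nonempty (G ≃g (cycleIdentify k c (glue (B ++ L))).graph)) ↔
      ∃ (c : Fin k) (ts M : List GraftTree), AllOrder3 M ∧ ts.Perm (bs ++ M) ∧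
        Nonempty (G ≃g ((pointedCycle k c).attach ts).graph) := by
  constructor
  · rintro ⟨L, hL, c, e⟩
    obtain ⟨M, hM, hLM⟩ := exists_forall₂_of_allP4OrClaw hL
    exact ⟨c, _, M, hM, List.Perm.refl _,
      (nonempty_iso_cycleIdentify_iff (List.rel_append hB hLM) (List.Perm.refl _)).1 e⟩
  · rintro ⟨c, ts, M, hM, hp, e⟩
    obtain ⟨L, hL, hLM⟩ := exists_forall₂_of_allOrder3 hM
    exact ⟨L, hL, c, (nonempty_iso_cycleIdentify_iff (List.rel_append hB hLM) hp).2 e⟩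

theorem mem_potFamily2_iff : G ∈ potFamily2 V k ↔ ∃ (c : Fin k) (ts : List GraftTree),
    Extremal1 ts ∧ Nonempty (G ≃g ((pointedCycle k c).attach ts).graph) := by
  refine (mem_edgeFamily_iff
    (.cons leafPath_two_isBranch (.cons leafPath_three_isBranch .nil))).trans ?_
  constructor
  · rintro ⟨c, t, M, hM, hp, e⟩
    exact ⟨c, _, ⟨t, M, rfl, hM, hp⟩, e⟩
  · rintro ⟨c, _, ⟨t, M, rfl, hM, hp⟩, e⟩
    exact ⟨c, t, M, hM, hp, e⟩

theorem mem_potFamily_union_iff : G ∈ potFamily3 V k ∪ potFamily4 V k ∪ potFamily5 V k ∪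
      potFamily6 V k ∪ potFamily7 V k ↔ ∃ (c : Fin k) (ts : List GraftTree),
    Extremal2 ts ∧ Nonempty (G ≃g ((pointedCycle k c).attach ts).graph) := by
  have h3 := mem_edgeFamily_iff (G := G) (k := k)
    (.cons leafPath_three_isBranch (.cons leafPath_three_isBranch .nil))
  have h4 := mem_edgeFamily_iff (G := G) (k := k) (.cons leafPath_two_isBranch
    (.cons leafPath_two_isBranch (.cons leafPath_three_isBranch .nil)))
  have h5 := mem_edgeFamily_iff (G := G) (k := k) (.cons leafPath_two_isBranch
    (.cons leafPath_two_isBranch (.cons leafPath_two_isBranch (.cons leafPath_two_isBranch .nil))))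
  have h6 := mem_identifyFamily_iff (G := G) (k := k) (.cons leafPath_three_isBranch .nil)
  have h7 := mem_identifyFamily_iff (G := G) (k := k)
    (.cons leafPath_two_isBranch (.cons leafPath_two_isBranch .nil))
  constructor
  · rintro ((((h | h) | h) | h) | h)
    · obtain ⟨c, t, M, hM, hp, e⟩ := h3.1 h
      exact ⟨c, _, ⟨M, hM, Or.inl ⟨t, rfl, Or.inl hp⟩⟩, e⟩
    · obtain ⟨c, t, M, hM, hp, e⟩ := h4.1 h
      exact ⟨c, _, ⟨M, hM, Or.inl ⟨t, rfl, Or.inr (Or.inl hp)⟩⟩, e⟩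
    · obtain ⟨c, t, M, hM, hp, e⟩ := h5.1 h
      exact ⟨c, _, ⟨M, hM, Or.inl ⟨t, rfl, Or.inr (Or.inr hp)⟩⟩, e⟩
    · obtain ⟨c, ts, M, hM, hp, e⟩ := h6.1 h
      exact ⟨c, ts, ⟨M, hM, Or.inr (Or.inl hp)⟩, e⟩
    · obtain ⟨c, ts, M, hM, hp, e⟩ := h7.1 h
      exact ⟨c, ts, ⟨M, hM, Or.inr (Or.inr hp)⟩, e⟩
  · rintro ⟨c, ts, ⟨M, hM, ⟨t, rfl, hp | hp | hp⟩ | hp | hp⟩, e⟩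
    · exact Or.inl (Or.inl (Or.inl (Or.inl (h3.2 ⟨c, t, M, hM, hp, e⟩))))
    · exact Or.inl (Or.inl (Or.inl (Or.inr (h4.2 ⟨c, t, M, hM, hp, e⟩))))
    · exact Or.inl (Or.inl (Or.inr (h5.2 ⟨c, t, M, hM, hp, e⟩)))
    · exact Or.inl (Or.inr (h6.2 ⟨c, ts, M, hM, hp, e⟩))
    · exact Or.inr (h7.2 ⟨c, ts, M, hM, hp, e⟩)

end Families

/-! ### The bounds are attained by the extremal lists -/

section Attained

theorem potCount_singleton {t : GraftTree} {a b c : ℕ} (h : t.count = ⟨.free, a, b, c⟩) :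
    potCount [t] = 3 * a + b + c := by
  simp [potCount, RootCount.attach, RootCount.join, RootCount.total, h]
  ring

theorem GraftTree.size_of_children_perm {t : GraftTree} {bs M : List GraftTree} (hM : AllOrder3 M)
    (h : t.children.Perm (bs ++ M)) : t.size = 1 + (bs.map size).sum + 3 * M.length := by
  rw [size_eq_children, (h.map size).sum_eq, List.map_append, List.sum_append,
    sum_size_of_allOrder3 hM, add_assoc]

theorem GraftTree.exists_count_of_children_perm {t : GraftTree} {bs M : List GraftTree} {a b c : ℕ}
    (hM : AllOrder3 M) (h : t.children.Perm (bs ++ M))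
    (hbs : leaf.count.attach bs = ⟨.free, a, b, c⟩) :
    ∃ p, (M = List.replicate M.length path3 → p = M.length) ∧
      t.count = ⟨.free, 3 ^ M.length * a, b, c + b * p⟩ := by
  obtain ⟨p, -, -, hp, hcount⟩ := RootCount.exists_attach_allOrder3 hM
  refine ⟨p, hp, ?_⟩
  rw [count_eq_attach, RootCount.attach_perm _ h, RootCount.attach_append, hbs, hcount]

theorem Extremal0.potCount_eq {ts : List GraftTree} (h : Extremal0 ts) :
    potCount ts = 3 ^ ((ts.map size).sum / 3) + (ts.map size).sum / 3 + 1 := by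
  obtain ⟨t, m, rfl, h⟩ := h
  have hM : AllOrder3 (List.replicate m path3) := fun s hs => Or.inl (List.eq_of_mem_replicate hs)
  obtain ⟨p, hp, hcount⟩ := exists_count_of_children_perm (bs := [path2]) (a := 1) (b := 1) (c := 1)
    hM h rfl
  have hsize := size_of_children_perm (bs := [path2]) hM h
  have h2 : ([path2].map size).sum = 2 := rfl
  rw [h2, List.length_replicate] at hsize
  rw [List.length_replicate] at hp hcount
  rw [potCount_singleton hcount, hp rfl, List.map_singleton, List.sum_singleton, hsize,
    (by omega : (1 + 2 + 3 * m) / 3 = m + 1), pow_succ]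
  ring

theorem Extremal1.potCount_eq {ts : List GraftTree} (h : Extremal1 ts) :
    potCount ts = 3 ^ ((ts.map size).sum / 3) + 1 := by
  obtain ⟨t, M, rfl, hM, h⟩ := h
  obtain ⟨p, -, hcount⟩ := exists_count_of_children_perm (bs := [leaf, path2])
    (a := 1) (b := 0) (c := 1) hM h rfl
  have hsize := size_of_children_perm (bs := [leaf, path2]) hM h
  have h2 : ([leaf, path2].map size).sum = 3 := rfl
  rw [h2] at hsize
  rw [potCount_singleton hcount, List.map_singleton, List.sum_singleton, hsize,
    (by omega : (1 + 3 + 3 * M.length) / 3 = M.length + 1), pow_succ]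
  ring

theorem potCount_singleton_of_children_perm {t : GraftTree} {bs M : List GraftTree}
    (hM : AllOrder3 M) (h : t.children.Perm (bs ++ M))
    (hbs : leaf.count.attach bs = ⟨.free, 1, 0, 0⟩) (hsum : (bs.map size).sum = 4) :
    potCount [t] = 3 ^ (([t].map size).sum / 3) := by
  obtain ⟨p, -, hcount⟩ := exists_count_of_children_perm hM h hbs
  have hsize := size_of_children_perm hM h
  rw [hsum] at hsize
  rw [potCount_singleton hcount, List.map_singleton, List.sum_singleton, hsize,
    (by omega : (1 + 4 + 3 * M.length) / 3 = M.length + 1), pow_succ]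
  ring

theorem potCount_of_perm {ts : List GraftTree} {i j : ℕ} {M : List GraftTree} (hM : AllOrder3 M)
    (h : ts.Perm (List.replicate i leaf ++ (List.replicate j path2 ++ M))) (hij : i + 2 * j = 2) :
    potCount ts = 3 ^ ((ts.map size).sum / 3) := by
  have hfree : ∃ t ∈ ts, t.count.kind ≠ .free := by
    rcases Nat.eq_zero_or_pos j with rfl | hj
    · refine ⟨leaf, h.mem_iff.2 ?_, (nofun : RootKind.isolated ≠ .free)⟩
      simp
      omega
    · refine ⟨path2, h.mem_iff.2 ?_, (nofun : RootKind.matched ≠ .free)⟩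
      simp
      omega
  rw [potCount_of_exists_not_free hfree, prod_total_of_perm hM h, sum_size_of_perm hM h]
  congr 1
  omega

theorem Extremal2.potCount_eq {ts : List GraftTree} (h : Extremal2 ts) :
    potCount ts = 3 ^ ((ts.map size).sum / 3) := by
  obtain ⟨M, hM, ⟨t, rfl, h | h | h⟩ | h | h⟩ := h
  · exact potCount_singleton_of_children_perm (bs := [path2, path2]) hM h rfl rfl
  · exact potCount_singleton_of_children_perm (bs := [leaf, leaf, path2]) hM h rfl rfl
  · exact potCount_singleton_of_children_perm (bs := [leaf, leaf, leaf, leaf]) hM h rfl rfl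
  · exact potCount_of_perm (i := 0) (j := 1) hM h rfl
  · exact potCount_of_perm (i := 2) (j := 0) hM h rfl

end Attained

theorem card_and_numMaxDissociationSets_of_iso {V : Type u} [Fintype V] {G : SimpleGraph V} {m : ℕ}
    (hm : 0 < m) {c : Fin (3 * m)} {ts : List GraftTree}
    (h : Nonempty (G ≃g ((pointedCycle (3 * m) c).attach ts).graph)) :
    Fintype.card V = 3 * m + (ts.map size).sum ∧ numMaxDissociationSets G = potCount ts := by
  obtain ⟨e⟩ := h
  obtain ⟨_, hcard, hcount⟩ := (pointedCycle_counted hm c).attach ts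
  refine ⟨(Fintype.card_congr e.toEquiv).trans hcard, ?_⟩
  rw [numMaxDissociationSets_congr e]
  by_cases hf : ∃ t ∈ ts, t.count.kind ≠ .free
  · rw [RootCount.attach_of_exists_not_free ts hf] at hcount
    rw [hcount.numMaxDissociationSets_eq (by simpa using prod_total_pos ts),
      potCount_of_exists_not_free hf]
    simp
  · push Not at hf
    rw [RootCount.attach_of_forall_free ts hf] at hcount
    rw [hcount.numMaxDissociationSets_eq (by simpa using prod_total_pos ts),
      potCount_of_forall_free hf]
    simp

end

theorem theorem1p1 {V : Type*} [Fintype V] (G : SimpleGraph V) (n k : ℕ)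
    (hn : k + 4 ≤ n) (hk : k ≡ 0 [MOD 3]) (hG : IsPotted G n k) :
    (n ≡ 0 [MOD 3] →
      numMaxDissociationSets G ≤ 3 ^ ((n - k) / 3) + (n - k) / 3 + 1 ∧
      (numMaxDissociationSets G = 3 ^ ((n - k) / 3) + (n - k) / 3 + 1 ↔
        G ∈ potFamily1 V k)) ∧
    (n ≡ 1 [MOD 3] →
      numMaxDissociationSets G ≤ 3 ^ ((n - k - 1) / 3) + 1 ∧
      (numMaxDissociationSets G = 3 ^ ((n - k - 1) / 3) + 1 ↔
        G ∈ potFamily2 V k)) ∧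
    (n ≡ 2 [MOD 3] →
      numMaxDissociationSets G ≤ 3 ^ ((n - k - 2) / 3) ∧
      (numMaxDissociationSets G = 3 ^ ((n - k - 2) / 3) ↔
        G ∈ potFamily3 V k ∪ potFamily4 V k ∪ potFamily5 V k ∪ potFamily6 V k ∪
          potFamily7 V k)) := by
  have hcardV := hG.1
  obtain ⟨h3, c, ts, w, e, -⟩ := hG.exists_pointedIso
  obtain ⟨m, rfl⟩ := (Nat.modEq_zero_iff_dvd).1 hk
  have hm : 0 < m := by omega
  rw [mem_potFamily1_iff, mem_potFamily2_iff, mem_potFamily_union_iff]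
  -- Stated for every presentation of `G`, since membership in a family may supply a cycle vertex
  -- and branches other than those found above.
  have hcount : ∀ {c : Fin (3 * m)} {ts : List GraftTree},
      Nonempty (G ≃g ((pointedCycle (3 * m) c).attach ts).graph) →
      (ts.map GraftTree.size).sum = n - 3 * m ∧ numMaxDissociationSets G = potCount ts := by
    intro c ts h
    obtain ⟨h1, h2⟩ := card_and_numMaxDissociationSets_of_iso hm h
    exact ⟨by omega, h2⟩
  obtain ⟨hN, hG⟩ := hcount ⟨e⟩
  obtain ⟨b0, b1, b2⟩ := potBound (ts := ts) (by omega)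
  rw [hN, ← hG] at b0 b1 b2
  simp only [Nat.ModEq]
  refine ⟨fun hmod => ?_, fun hmod => ?_, fun hmod => ?_⟩
  · obtain ⟨hle, heq⟩ := b0 (by omega)
    refine ⟨hle, fun h => ⟨c, ts, heq h, ⟨e⟩⟩, ?_⟩
    rintro ⟨c', ts', hts, e'⟩
    obtain ⟨h1, h2⟩ := hcount e'
    rw [h2, hts.potCount_eq, h1]
  · rw [(by omega : (n - 3 * m - 1) / 3 = (n - 3 * m) / 3)]
    obtain ⟨hle, heq⟩ := b1 (by omega)
    refine ⟨hle, fun h => ⟨c, ts, heq h, ⟨e⟩⟩, ?_⟩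
    rintro ⟨c', ts', hts, e'⟩
    obtain ⟨h1, h2⟩ := hcount e'
    rw [h2, hts.potCount_eq, h1]
  · rw [(by omega : (n - 3 * m - 2) / 3 = (n - 3 * m) / 3)]
    obtain ⟨hle, heq⟩ := b2 (by omega)
    refine ⟨hle, fun h => ⟨c, ts, heq h, ⟨e⟩⟩, ?_⟩
    rintro ⟨c', ts', hts, e'⟩
    obtain ⟨h1, h2⟩ := hcount e'
    rw [h2, hts.potCount_eq, h1]
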